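/- **Setting.** Let $d\ge 1$ be an integer, $\alpha>0$, $\delta=d/\alpha$, and let $c_d=\pi^{d/2}/\Gamma(1+d/2)$ be the volume of the unit ball of $\mathbb{R}^d$. Let $y_1,y_2,\dots$ be the points of a stationary Poisson point process of intensity $1$ in $\mathbb{R}^d$, numbered by increasing Euclidean distance to the origin. Put $r_i=\|y_i\|$, $x_i=r_i^{\alpha}$, and $\Phi(B)=\#\{i: x_i\in B\}$ for Borel $B\subset\mathbb{R}$. Let $f_1,f_2,\dots$ be iid random variables, independent of $(y_i)$, with values in $[0,\infty)$, mean $1$ and distribution function $F$, and put $\xi_i=x_i/f_i\in[0,\infty]$ (with $\xi_i=\infty$ where $f_i=0<x_i$). Write $F_X(x)=\mathbb{P}(X\le x)$ for the distribution function of $X$, $\Lambda(B)=\mathbb{E}\,\Phi(B)$, $\Lambda(x)=\Lambda([0,x))$, and $\Gamma_{\mathrm{ic}}(a,x)=\int_x^\infty t^{a-1}e^{-t}\,dt$. Nakagami-$m$ fading ($m>0$ real) means that the $f_i$ have the density $m^m x^{m-1}e^{-mx}/\Gamma(m)$ on $(0,\infty)$; the standard network is the case $\delta=1$, $F(x)=1-e^{-x}$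 for $x\ge 0$ and $F(x)=0$ for $x<0$ (Rayleigh fading). **Corollary (Basic properties).** For every $i\ge 1$: (a) $\Lambda(x)=c_d x^{\delta}$ for $x\ge 0$, and $\Lambda$ has the density $\lambda(x)=d\Lambda(x)/dx=c_d\,\delta\, x^{\delta-1}$ on $(0,\infty)$ (and no mass on $(-\infty,0]$). In particular, for $\delta=1$ the process $\Phi$ is stationary on $[0,\infty)$: for all Borel sets $B_1,\dots,B_n\subset[0,\infty)$ and $t\ge 0$, the vectors $(\Phi(B_j+t))_{j\le n}$ and $(\Phi(B_j))_{j\le n}$ have the same law. (b) $r_i$ has the generalized gamma density $$f_{r_i}(r)=e^{-c_d r^d}\,\frac{d\,(c_d r^d)^i}{r\,\Gamma(i)},\qquad r>0,$$ and $x_i$ has the distribution function $$F_{x_i}(x)=1-\frac{\Gamma_{\mathrm{ic}}(i,c_d x^{\delta})}{\Gamma(i)}\quad(x\ge 0),\qquad F_{x_i}(x)=0\quad (x<0).$$ Moreover $x_i$ is integrable with $$\mathbb{E}\,x_i=c_d^{-1/\delta}\,\frac{\Gamma(i+1/\delta)}{\Gamma(i)}.$$ In particular, if $\delta=1$ (hence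 in the standard network), $x_i$ is Erlang distributed with shape $i$ and rate $c_d$, and $\mathbb{E}\,x_i=i/c_d$. (c) $F_{\xi_i}(x)=0$ for $x\le 0$, and for $x>0$ $$F_{\xi_i}(x)=1-\int_0^\infty F(r/x)\,\frac{c_d^{\,i}\,\delta\, r^{\delta i-1}e^{-c_d r^{\delta}}}{\Gamma(i)}\,dr,$$ where the integral converges. For $\delta=1$ and Nakagami-$m$ fading, $m>0$, $\xi_i$ is almost surely finite with density $$f_{\xi_i}(x)=\frac{m^{m+1}\binom{m+i-1}{m}c_d^{\,i}\,x^{i-1}}{(m+c_d x)^{m+i}},\qquad x>0,$$ where $\binom{a}{b}=\Gamma(a+1)/(\Gamma(b+1)\Gamma(a-b+1))$. In particular $$F_{\xi_1}(x)=1-\Bigl(\frac{m}{c_d x+m}\Bigr)^m\quad(x\ge 0),$$ $\xi_i$ is integrable if $m>1$ and square-integrable if $m>2$, with $$\mathbb{E}\,\xi_i=\frac{m\,i}{c_d(m-1)}\quad(m>1),\qquad \operatorname{Var}\xi_i=\frac{m^2\,i\,(m+i-1)}{c_d^2(m-1)^2(m-2)}\quad(m>2).$$ In the standard network, $$F_{\xi_i}(x)=\Bigl(\frac{c_d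 x}{c_d x+1}\Bigr)^i\quad(x\ge 0).$$ -/

import Mathlib

open MeasureTheory ProbabilityTheory Set
open scoped ENNReal NNReal

noncomputable section

/-- The number of indices `i` with `p i ω ∈ B`, i.e. the random counting measure `∑ᵢ δ_{pᵢ}` of the
enumerated points `p 1, p 2, …` evaluated at the set `B`. -/
def pointCount {Ω S : Type*} (p : ℕ+ → Ω → S) (B : Set S) (ω : Ω) : ℕ∞ :=
  {i : ℕ+ | p i ω ∈ B}.encard

/-- `y 1, y 2, …` are the points of a stationary Poisson point process of intensity `1` in `ℝ^d`:
counts in Borel sets of finite volume are Poisson with mean the volume, and counts in finitely many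
pairwise disjoint Borel sets are independent. -/
structure IsUnitPoissonProcess {Ω : Type*} [MeasurableSpace Ω] (μ : Measure Ω) {d : ℕ}
    (y : ℕ+ → Ω → EuclideanSpace ℝ (Fin d)) : Prop where
  measurable : ∀ i, Measurable (y i)
  poisson : ∀ B : Set (EuclideanSpace ℝ (Fin d)), MeasurableSet B → volume B ≠ ∞ →
    HasLaw (pointCount y B)
      ((poissonMeasure (volume B).toNNReal).map (Nat.cast : ℕ → ℕ∞)) μ
  indep : ∀ (n : ℕ) (B : Fin n → Set (EuclideanSpace ℝ (Fin d))),
    (∀ j, MeasurableSet (B j)) → Pairwise (fun j k => Disjoint (B j) (B k)) →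
    iIndepFun (fun j => pointCount y (B j)) μ

/-- The points are numbered by their Euclidean distance to the origin, almost surely. -/
def OrderedByDistance {Ω : Type*} [MeasurableSpace Ω] (μ : Measure Ω) {d : ℕ}
    (y : ℕ+ → Ω → EuclideanSpace ℝ (Fin d)) : Prop :=
  ∀ᵐ ω ∂μ, Monotone (fun i => ‖y i ω‖)

/-- `ν` is an admissible fading distribution: a law on `[0,∞)` with mean `1`. -/
structure IsFadingLaw (ν : Measure ℝ) : Prop where
  prob : IsProbabilityMeasure ν
  nonneg : ν (Iio 0) = 0
  integrable : Integrable (fun t => t) ν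
  mean_one : ∫ t, t ∂ν = 1

/-- `f 1, f 2, …` are iid with law `ν`, and independent of the points `y 1, y 2, …`. -/
structure IsFading {Ω : Type*} [MeasurableSpace Ω] (μ : Measure Ω) {d : ℕ}
    (y : ℕ+ → Ω → EuclideanSpace ℝ (Fin d)) (f : ℕ+ → Ω → ℝ) (ν : Measure ℝ) : Prop where
  measurable : ∀ i, Measurable (f i)
  law : ∀ i, HasLaw (f i) ν μ
  indep : iIndepFun f μ
  indep_points : IndepFun (fun ω i => f i ω) (fun ω i => y i ω) μ

/-- The distance `r_i = ‖y_i‖` of the `i`-th nearest node. -/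
def nodeDist {Ω : Type*} {d : ℕ} (y : ℕ+ → Ω → EuclideanSpace ℝ (Fin d)) (i : ℕ+) (ω : Ω) : ℝ :=
  ‖y i ω‖

/-- The path loss before fading `x_i = r_i ^ α`. -/
def pathLoss {Ω : Type*} {d : ℕ} (α : ℝ) (y : ℕ+ → Ω → EuclideanSpace ℝ (Fin d)) (i : ℕ+)
    (ω : Ω) : ℝ :=
  nodeDist y i ω ^ α

/-- The path loss with fading `ξ_i = x_i / f_i`, with values in `[0,∞]`: it is `∞` where `f_i = 0`
and `x_i > 0`. -/
def fadedPathLoss {Ω : Type*} {d : ℕ} (α : ℝ) (y : ℕ+ → Ω → EuclideanSpace ℝ (Fin d))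
    (f : ℕ+ → Ω → ℝ) (i : ℕ+) (ω : Ω) : ℝ≥0∞ :=
  ENNReal.ofReal (pathLoss α y i ω) / ENNReal.ofReal (f i ω)

/-- The distribution function `x ↦ P(X ≤ x)` on `ℝ` of a `[0,∞]`-valued random variable. -/
def extCdf {Ω : Type*} [MeasurableSpace Ω] (μ : Measure Ω) (X : Ω → ℝ≥0∞) (x : ℝ) : ℝ :=
  μ.real {ω | (X ω : EReal) ≤ (x : EReal)}

/-- The intensity (counting) measure `B ↦ E[#{i : p_i ∈ B}]` of a point process on the line. -/
def meanCount {Ω : Type*} [MeasurableSpace Ω] (μ : Measure Ω) (p : ℕ+ → Ω → ℝ) (B : Set ℝ) :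
    ℝ≥0∞ :=
  ∫⁻ ω, (pointCount p B ω : ℝ≥0∞) ∂μ

/-- Stationarity on `[0,∞)`: the joint law of the counts in finitely many Borel subsets of `[0,∞)`
does not change when the sets are shifted by `t ≥ 0`. -/
def IsStationaryOnHalfLine {Ω : Type*} [MeasurableSpace Ω] (μ : Measure Ω) (p : ℕ+ → Ω → ℝ) :
    Prop :=
  ∀ t : ℝ, 0 ≤ t → ∀ (n : ℕ) (B : Fin n → Set ℝ),
    (∀ j, MeasurableSet (B j)) → (∀ j, B j ⊆ Ici 0) →
    IdentDistrib (fun ω j => pointCount p ((fun s => t + s) '' B j) ω)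
      (fun ω j => pointCount p (B j) ω) μ μ

/-- The volume of the `d`-dimensional unit ball, `c_d = π^{d/2} / Γ(1 + d/2)`. -/
def ballConst (d : ℕ) : ℝ := Real.pi ^ ((d : ℝ) / 2) / Real.Gamma (1 + (d : ℝ) / 2)

/-- The upper incomplete gamma function. -/
def upperGamma (a x : ℝ) : ℝ := ∫ t in Ioi x, t ^ (a - 1) * Real.exp (-t)

/-- The binomial coefficient `a choose b` for real `a ≥ b ≥ 0`, through the Gamma function. -/
def realBinom (a b : ℝ) : ℝ :=
  Real.Gamma (a + 1) / (Real.Gamma (b + 1) * Real.Gamma (a - b + 1))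

/-- `X` has the probability density `g` on `(0,∞)` (and density `0` elsewhere). -/
def HasDensityOnPos {Ω : Type*} [MeasurableSpace Ω] (μ : Measure Ω) (X : Ω → ℝ) (g : ℝ → ℝ) :
    Prop :=
  HasLaw X ((volume.restrict (Ioi (0 : ℝ))).withDensity (fun t => ENNReal.ofReal (g t))) μ

end

/-! The key quantity is `T z = ballConst d * ‖z‖ ^ d`, the volume of the ball through `z`. The
closed ball of volume `x` contains a Poisson number of points with mean `x`. By the ordering, `T (y
i) > x` means that this ball contains fewer than `i` points. The probability of that event is the
Poisson partial sum, which is also the Erlang tail (`gammaMeasure_Ioi`), so `T (y i)` is Erlang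
(`hasLaw_ballConst_mul_nodeDist_pow`). Since `T (y i) = c * x_i ^ δ`, the laws and moments in (b)
follow by the power substitution `hasLaw_posDensity_of_mul_rpow`.

For (a), the laws of the points sum to the volume (`IsUnitPoissonProcess.sum_map_eq_volume`), so the
intensity of the path losses is the image of the volume under `z ↦ ‖z‖ ^ α`. When `δ = 1` this image
is a multiple of Lebesgue measure on the half-line. The joint law of the counts depends only on the
volumes of the atoms generated by the sets
(`IsUnitPoissonProcess.identDistrib_of_volume_atomOf_eq`), and translation preserves these.

For (c), independence and Fubini turn `P(x_i ≤ x f_i)` into an integral of the fading distribution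
function (`extCdf_ofReal_div_eq`). For `δ = 1`, Nakagami fading makes `ξ_i` a quotient of
independent gamma variables: its density is beta prime (`hasLaw_div_of_gammaMeasure`), and its
moments factor (`moment_div_of_gammaMeasure`). Under Rayleigh fading the integral reduces to the
Laplace transform of an Erlang law. -/

/-! ### Densities on the positive half-line. -/

/-- The measure on `ℝ` with density `g` on `(0,∞)` and no mass elsewhere. -/
noncomputable def posDensity (g : ℝ → ℝ) : Measure ℝ :=
  (volume.restrict (Ioi (0 : ℝ))).withDensity (fun t => ENNReal.ofReal (g t))

lemma posDensity_apply (g : ℝ → ℝ) {B : Set ℝ} (hB : MeasurableSet B) :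
    posDensity g B = ∫⁻ x in B ∩ Ioi 0, ENNReal.ofReal (g x) := by
  rw [posDensity, withDensity_apply _ hB, Measure.restrict_restrict hB]

lemma posDensity_congr {g h : ℝ → ℝ} (H : ∀ x, 0 < x → g x = h x) :
    posDensity g = posDensity h := by
  refine withDensity_congr_ae ?_
  filter_upwards [ae_restrict_mem measurableSet_Ioi] with x hx
  rw [H x hx]

lemma posDensity_Iic_zero (g : ℝ → ℝ) : posDensity g (Iic 0) = 0 := by
  rw [posDensity_apply g measurableSet_Iic]
  have : Iic (0 : ℝ) ∩ Ioi 0 = ∅ := by ext x; simp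
  simp [this]

instance nullSingletonClass_posDensity (g : ℝ → ℝ) : NullSingletonClass (posDensity g) := by
  unfold posDensity; infer_instance

lemma integral_posDensity {g : ℝ → ℝ} (hg : Measurable g) (h0 : ∀ x, 0 < x → 0 ≤ g x)
    (u : ℝ → ℝ) : ∫ x, u x ∂(posDensity g) = ∫ x in Ioi 0, u x * g x := by
  rw [posDensity, integral_withDensity_eq_integral_toReal_smul (by fun_prop) (by simp)]
  refine setIntegral_congr_fun measurableSet_Ioi fun x hx => ?_
  simp [ENNReal.toReal_ofReal (h0 x hx), mul_comm]

lemma integrable_posDensity_iff {g : ℝ → ℝ} (hg : Measurable g) (h0 : ∀ x, 0 < x → 0 ≤ g x)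
    {u : ℝ → ℝ} :
    Integrable u (posDensity g) ↔ IntegrableOn (fun x => u x * g x) (Ioi 0) := by
  rw [posDensity, integrable_withDensity_iff (by fun_prop) (by simp)]
  refine integrableOn_congr_fun (fun x hx => ?_) measurableSet_Ioi
  simp [ENNReal.toReal_ofReal (h0 x hx)]

/-- `gammaPDF` is supported on `[0,∞)` rather than `(0,∞)`; the extra point `0` is null. -/
lemma gammaMeasure_eq_posDensity (a r : ℝ) :
    gammaMeasure a r
      = posDensity (fun x => r ^ a / Real.Gamma a * x ^ (a - 1) * Real.exp (-(r * x))) := by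
  ext B hB
  rw [posDensity_apply _ hB, gammaMeasure, withDensity_apply _ hB,
    ← Measure.restrict_restrict hB]
  have h1 : ∫⁻ x in B, gammaPDF a r x = ∫⁻ x in B, (Ici (0 : ℝ)).indicator (gammaPDF a r) x := by
    refine lintegral_congr fun x => ?_
    by_cases hx : 0 ≤ x
    · rw [indicator_of_mem (by simpa using hx)]
    · rw [indicator_of_notMem (by simpa using hx), gammaPDF_of_neg (by simpa using hx)]
  rw [h1, lintegral_indicator measurableSet_Ici, Measure.restrict_restrict measurableSet_Ici,
    Measure.restrict_restrict hB, inter_comm, ← setLIntegral_congr (s := B ∩ Ioi 0)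
      (ae_eq_set_inter (Filter.EventuallyEq.refl _ _) Ioi_ae_eq_Ici)]
  refine setLIntegral_congr_fun (hB.inter measurableSet_Ioi) fun x hx => ?_
  exact gammaPDF_of_nonneg (le_of_lt hx.2)

lemma ae_pos_of_hasLaw_posDensity {S : Type*} [MeasurableSpace S] {μ : Measure S} {X : S → ℝ}
    {g : ℝ → ℝ} (h : HasLaw X (posDensity g) μ) :
    ∀ᵐ ω ∂μ, 0 < X ω := by
  have := h.measure_eq (p := fun t => t ≤ 0) measurableSet_Iic
  rw [show {x : ℝ | x ≤ 0} = Iic 0 from rfl, posDensity_Iic_zero] at this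
  rw [ae_iff]
  simpa using this

/-- Change of variables: if `c * X ^ q` has density `g` on `(0,∞)` then `X` has density
`c q x^(q-1) g (c x^q)` there. -/
lemma hasLaw_posDensity_of_mul_rpow {S : Type*} [MeasurableSpace S] {P : Measure S} {X : S → ℝ}
    (hX : Measurable X) (h0 : ∀ s, 0 ≤ X s) {c q : ℝ} (hc : 0 < c) (hq : 0 < q) {g : ℝ → ℝ}
    (hT : HasLaw (fun s => c * X s ^ q) (posDensity g) P) :
    HasLaw X (posDensity (fun x => c * q * x ^ (q - 1) * g (c * x ^ q))) P := by
  refine ⟨hX.aemeasurable, ?_⟩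
  ext B hB
  have hinj : InjOn (fun x : ℝ => c * x ^ q) (Ici 0) := by
    intro x hx y hy hxy
    have h : x ^ q = y ^ q := mul_left_cancel₀ hc.ne' hxy
    exact (Real.rpow_left_inj hx hy hq.ne').1 h
  have hder : ∀ x ∈ B ∩ Ioi 0, HasDerivWithinAt (fun x : ℝ => c * x ^ q) (c * (q * x ^ (q - 1)))
      (B ∩ Ioi 0) x := fun x hx =>
    ((Real.hasDerivAt_rpow_const (Or.inl hx.2.ne')).const_mul c).hasDerivWithinAt
  have hsub : B ∩ Ioi 0 ⊆ Ici (0 : ℝ) := fun x hx => mem_Ici.2 (le_of_lt hx.2)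
  have himg : MeasurableSet ((fun x : ℝ => c * x ^ q) '' (B ∩ Ioi 0)) :=
    (hB.inter measurableSet_Ioi).image_of_continuousOn_injOn
      (fun x hx => (hder x hx).continuousWithinAt) (hinj.mono hsub)
  -- The image already lies in `(0,∞)`, so restricting the density of `c * X ^ q` to `(0,∞)` loses
  -- nothing.
  have hpos : (fun x : ℝ => c * x ^ q) '' (B ∩ Ioi 0) ∩ Ioi 0
      = (fun x : ℝ => c * x ^ q) '' (B ∩ Ioi 0) := by
    refine inter_eq_left.2 ?_
    rintro _ ⟨x, hx, rfl⟩
    exact mul_pos hc (Real.rpow_pos_of_pos hx.2 q)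
  -- The power map is injective only on `[0,∞)`, and the value `X s = 0` is excluded almost surely
  -- because `c * X ^ q` is then positive.
  have h1 : P {s | X s ∈ B}
      = P {s | c * X s ^ q ∈ (fun x : ℝ => c * x ^ q) '' (B ∩ Ioi 0)} := by
    refine measure_congr ?_
    filter_upwards [ae_pos_of_hasLaw_posDensity hT] with s hs
    have hXs : 0 < X s := by
      refine lt_of_le_of_ne (h0 s) fun h => ?_
      rw [← h, Real.zero_rpow hq.ne'] at hs
      simp at hs
    refine propext ⟨fun h => ⟨X s, ⟨h, hXs⟩, rfl⟩, ?_⟩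
    rintro ⟨x, hx, hxs⟩
    have := hinj (hsub hx) (h0 s) hxs
    rw [this] at hx
    exact hx.1
  rw [Measure.map_apply hX hB, posDensity_apply _ hB]
  change P {s | X s ∈ B} = _
  rw [h1, hT.measure_eq (p := fun t => t ∈ (fun x : ℝ => c * x ^ q) '' (B ∩ Ioi 0)) himg]
  change posDensity g ((fun x : ℝ => c * x ^ q) '' (B ∩ Ioi 0)) = _
  rw [posDensity_apply _ himg, hpos,
    lintegral_image_eq_lintegral_abs_deriv_mul (hB.inter measurableSet_Ioi) hder (hinj.mono hsub)]
  refine setLIntegral_congr_fun (hB.inter measurableSet_Ioi) fun x hx => ?_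
  have hx0 : 0 ≤ x ^ (q - 1) := Real.rpow_nonneg (le_of_lt hx.2) _
  change _ = ENNReal.ofReal (c * q * x ^ (q - 1) * g (c * x ^ q))
  rw [ENNReal.ofReal_mul (by positivity), abs_of_nonneg (by positivity), mul_assoc c q]

/-! ### Moments and tails of gamma distributions. -/

lemma integrableOn_rpow_mul_exp_neg_mul {a r : ℝ} (ha : 0 < a) (hr : 0 < r) :
    IntegrableOn (fun t : ℝ => t ^ (a - 1) * Real.exp (-(r * t))) (Ioi 0) := by
  have h := integrableOn_rpow_mul_exp_neg_mul_rpow (p := 1) (s := a - 1) (b := r)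
    (by linarith) one_pos hr
  simpa using h

lemma lintegral_rpow_mul_exp_neg_mul {a r : ℝ} (ha : 0 < a) (hr : 0 < r) :
    ∫⁻ t in Ioi (0 : ℝ), ENNReal.ofReal (t ^ (a - 1) * Real.exp (-(r * t)))
      = ENNReal.ofReal (Real.Gamma a / r ^ a) := by
  rw [← ofReal_integral_eq_lintegral_ofReal (integrableOn_rpow_mul_exp_neg_mul ha hr),
    Real.integral_rpow_mul_exp_neg_mul_Ioi ha hr, one_div, Real.inv_rpow hr.le, div_eq_inv_mul]
  filter_upwards [ae_restrict_mem measurableSet_Ioi] with t ht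
  exact mul_nonneg (Real.rpow_nonneg (le_of_lt ht) _) (Real.exp_pos _).le

lemma gamma_density_nonneg {a r : ℝ} (ha : 0 < a) (hr : 0 < r) (x : ℝ) (hx : 0 < x) :
    0 ≤ r ^ a / Real.Gamma a * x ^ (a - 1) * Real.exp (-(r * x)) := by positivity

lemma integrable_rpow_gammaMeasure {a r s : ℝ} (ha : 0 < a) (hr : 0 < r) (hs : 0 < a + s) :
    Integrable (fun t => t ^ s) (gammaMeasure a r) := by
  rw [gammaMeasure_eq_posDensity,
    integrable_posDensity_iff (by fun_prop) (gamma_density_nonneg ha hr)]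
  refine IntegrableOn.congr_fun
    ((integrableOn_rpow_mul_exp_neg_mul hs hr).const_mul (r ^ a / Real.Gamma a))
    (fun x hx => ?_) measurableSet_Ioi
  have : x ^ (a + s - 1) = x ^ s * x ^ (a - 1) := by
    rw [← Real.rpow_add hx]; ring_nf
  simp only [this]; ring

lemma integral_rpow_gammaMeasure {a r s : ℝ} (ha : 0 < a) (hr : 0 < r) (hs : 0 < a + s) :
    ∫ t, t ^ s ∂(gammaMeasure a r) = Real.Gamma (a + s) / (Real.Gamma a * r ^ s) := by
  rw [gammaMeasure_eq_posDensity,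
    integral_posDensity (by fun_prop) (gamma_density_nonneg ha hr)]
  have h : ∀ x ∈ Ioi (0 : ℝ), x ^ s * (r ^ a / Real.Gamma a * x ^ (a - 1) * Real.exp (-(r * x)))
      = r ^ a / Real.Gamma a * (x ^ (a + s - 1) * Real.exp (-(r * x))) := fun x hx => by
    have : x ^ (a + s - 1) = x ^ s * x ^ (a - 1) := by
      rw [← Real.rpow_add hx]; ring_nf
    rw [this]; ring
  rw [setIntegral_congr_fun measurableSet_Ioi h, integral_const_mul,
    Real.integral_rpow_mul_exp_neg_mul_Ioi hs hr, one_div, Real.inv_rpow hr.le, Real.rpow_add hr]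
  have := (Real.Gamma_pos_of_pos ha).ne'
  have := (Real.rpow_pos_of_pos hr a).ne'
  have := (Real.rpow_pos_of_pos hr s).ne'
  field_simp

/-- This gives an explicit antiderivative of the Erlang density. The derivative telescopes:
differentiating the polynomial factor of each new term cancels the derivative obtained so far. -/
lemma hasDerivAt_neg_exp_mul_sum (n : ℕ) (t : ℝ) :
    HasDerivAt (fun t : ℝ => -(Real.exp (-t) * ∑ k ∈ Finset.range (n + 1), t ^ k / k.factorial))
      (Real.exp (-t) * (t ^ n / n.factorial)) t := by
  induction n with
  | zero => simpa using (hasDerivAt_neg t).exp.fun_neg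
  | succ n ih =>
    have he : HasDerivAt (fun t : ℝ => Real.exp (-t)) (-Real.exp (-t)) t := by
      simpa using (hasDerivAt_neg t).exp
    have hp : HasDerivAt (fun t : ℝ => t ^ (n + 1) / (n + 1).factorial)
        (t ^ n / n.factorial) t := by
      have := (hasDerivAt_pow (n + 1) t).div_const ((n + 1).factorial : ℝ)
      convert! this using 1
      rw [Nat.factorial_succ]
      have : (n.factorial : ℝ) ≠ 0 := by positivity
      push_cast
      field_simp
    have h := ih.sub (he.mul hp)
    convert! h using 1
    · ext t
      simp only [Pi.sub_apply, Pi.mul_apply, Finset.sum_range_succ _ (n + 1)]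
      ring
    · ring

lemma tendsto_exp_neg_mul_sum (n : ℕ) :
    Filter.Tendsto (fun t : ℝ => Real.exp (-t) * ∑ k ∈ Finset.range n, t ^ k / k.factorial)
      Filter.atTop (nhds 0) := by
  have h : Filter.Tendsto (fun t : ℝ => ∑ k ∈ Finset.range n,
      t ^ k * Real.exp (-t) / k.factorial) Filter.atTop
      (nhds (∑ k ∈ Finset.range n, 0 / (k.factorial : ℝ))) :=
    tendsto_finsetSum _ fun k _ =>
      (Real.tendsto_pow_mul_exp_neg_atTop_nhds_zero k).div_const _
  simp only [zero_div, Finset.sum_const_zero] at h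
  refine h.congr fun t => ?_
  rw [Finset.mul_sum]
  exact Finset.sum_congr rfl fun k _ => by ring

/-- The tail of the Erlang distribution. -/
lemma gammaMeasure_Ioi (n : ℕ) {x : ℝ} (hx : 0 ≤ x) :
    gammaMeasure (n + 1 : ℕ) 1 (Ioi x)
      = ENNReal.ofReal (Real.exp (-x) * ∑ k ∈ Finset.range (n + 1), x ^ k / k.factorial) := by
  rw [gammaMeasure_eq_posDensity, posDensity_apply _ measurableSet_Ioi,
    inter_eq_left.2 (Ioi_subset_Ioi hx)]
  have hd : ∀ t ∈ Ioi x, ENNReal.ofReal ((1 : ℝ) ^ ((n + 1 : ℕ) : ℝ) / Real.Gamma (n + 1 : ℕ)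
      * t ^ (((n + 1 : ℕ) : ℝ) - 1) * Real.exp (-(1 * t)))
      = ENNReal.ofReal (Real.exp (-t) * (t ^ n / n.factorial)) := fun t _ => by
    congr 1
    push_cast
    rw [Real.Gamma_nat_eq_factorial, Real.one_rpow, add_sub_cancel_right, Real.rpow_natCast]
    ring_nf
  have hnn : ∀ t ∈ Ioi x, 0 ≤ Real.exp (-t) * (t ^ n / n.factorial) := fun t ht => by
    have : 0 < t := lt_of_le_of_lt hx ht
    positivity
  have ht := (tendsto_exp_neg_mul_sum (n + 1)).neg
  rw [setLIntegral_congr_fun measurableSet_Ioi hd, ← ofReal_integral_eq_lintegral_ofReal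
      (integrableOn_Ioi_deriv_of_nonneg' (fun t _ => hasDerivAt_neg_exp_mul_sum n t) hnn ht)
      ((ae_restrict_mem measurableSet_Ioi).mono hnn),
    integral_Ioi_of_hasDerivAt_of_nonneg' (fun t _ => hasDerivAt_neg_exp_mul_sum n t) hnn ht]
  simp

/-- Puts the Erlang tail in the incomplete gamma form needed for the distribution function of `x_i`.
-/
lemma gammaMeasure_one_real_Ioi {a x : ℝ} (ha : 0 < a) (hx : 0 ≤ x) :
    (gammaMeasure a 1).real (Ioi x) = upperGamma a x / Real.Gamma a := by
  rw [measureReal_def, gammaMeasure_eq_posDensity, posDensity_apply _ measurableSet_Ioi,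
    inter_eq_left.2 (Ioi_subset_Ioi hx), ← integral_eq_lintegral_of_nonneg_ae, upperGamma,
    ← integral_div]
  · refine integral_congr_ae (Filter.Eventually.of_forall fun t => ?_)
    simp only [Real.one_rpow, one_mul]
    ring
  · filter_upwards [ae_restrict_mem measurableSet_Ioi] with t ht
    exact gamma_density_nonneg ha one_pos t (lt_of_le_of_lt hx ht)
  · fun_prop

/-! ### Mean counts and the Poisson distribution. -/

lemma toENNReal_pointCount {Ω S : Type*} (p : ℕ+ → Ω → S) (B : Set S) (ω : Ω) :
    (pointCount p B ω : ℝ≥0∞) = ∑' i, (p i ⁻¹' B).indicator 1 ω := by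
  rw [pointCount, ← ENNReal.tsum_set_one, tsum_subtype {i : ℕ+ | p i ω ∈ B} (fun _ => 1)]
  rfl

section Counts

variable {Ω S : Type*} [MeasurableSpace Ω] [MeasurableSpace S] {p : ℕ+ → Ω → S}

lemma lintegral_pointCount (μ : Measure Ω) (hp : ∀ i, Measurable (p i)) {B : Set S}
    (hB : MeasurableSet B) :
    ∫⁻ ω, (pointCount p B ω : ℝ≥0∞) ∂μ = Measure.sum (fun i => μ.map (p i)) B := by
  simp only [toENNReal_pointCount]
  rw [lintegral_tsum fun i => (measurable_one.indicator (hp i hB)).aemeasurable,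
    Measure.sum_apply _ hB]
  refine tsum_congr fun i => ?_
  rw [lintegral_indicator_one (hp i hB), Measure.map_apply (hp i) hB]

end Counts

lemma lintegral_natCast_poissonMeasure (r : ℝ≥0) :
    ∫⁻ n, (n : ℝ≥0∞) ∂(poissonMeasure r) = r := by
  rw [poissonMeasure, lintegral_sum_measure]
  simp only [lintegral_smul_measure, lintegral_dirac, smul_eq_mul]
  -- The term `n = 0` vanishes; in the others `n / n!` cancels to `1 / (n - 1)!`, leaving `r` times
  -- the total Poisson mass.
  rw [tsum_eq_zero_add' ENNReal.summable]
  have h : ∀ n : ℕ, ENNReal.ofReal (Real.exp (-r) * r ^ (n + 1) / (n + 1).factorial)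
      * ((n + 1 : ℕ) : ℝ≥0∞)
      = r * ENNReal.ofReal (Real.exp (-r) * r ^ n / n.factorial) := fun n => by
    rw [← ENNReal.ofReal_natCast, ← ENNReal.ofReal_mul (by positivity),
      ← ENNReal.ofReal_coe_nnreal, ← ENNReal.ofReal_mul (by positivity), Nat.factorial_succ]
    congr 1
    push_cast
    field_simp
    ring
  simp only [h]
  rw [ENNReal.tsum_mul_left, ← ENNReal.ofReal_tsum_of_nonneg (fun n => by positivity)
    (hasSum_one_poissonMeasure r).summable, (hasSum_one_poissonMeasure r).tsum_eq]
  simp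

lemma poissonMeasure_setOf_lt (r : ℝ≥0) (n : ℕ) :
    poissonMeasure r {k | k < n}
      = ENNReal.ofReal (Real.exp (-r) * ∑ k ∈ Finset.range n, (r : ℝ) ^ k / k.factorial) := by
  have : {k : ℕ | k < n} = (Finset.range n : Set ℕ) := by ext; simp
  rw [this, ← sum_measure_singleton, Finset.mul_sum,
    ENNReal.ofReal_sum_of_nonneg fun k _ => by positivity]
  refine Finset.sum_congr rfl fun k _ => ?_
  rw [poissonMeasure_singleton, mul_div_assoc]

/-! ### Counts and intensity of the Poisson process. -/

section Poisson

variable {Ω : Type*} [MeasurableSpace Ω] {μ : Measure Ω} {d : ℕ}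
  {y : ℕ+ → Ω → EuclideanSpace ℝ (Fin d)}

lemma IsUnitPoissonProcess.measure_pointCount_lt (hy : IsUnitPoissonProcess μ y)
    {B : Set (EuclideanSpace ℝ (Fin d))} (hB : MeasurableSet B) (hv : volume B ≠ ∞) (n : ℕ) :
    μ {ω | pointCount y B ω < n} = ENNReal.ofReal (Real.exp (-(volume B).toReal)
      * ∑ k ∈ Finset.range n, (volume B).toReal ^ k / k.factorial) := by
  rw [(hy.poisson B hB hv).measure_eq (p := fun k => k < (n : ℕ∞)) (.of_discrete),
    Measure.map_apply (by fun_prop) .of_discrete]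
  have : (Nat.cast : ℕ → ℕ∞) ⁻¹' {k | k < (n : ℕ∞)} = {k | k < n} := by ext; simp
  rw [this, poissonMeasure_setOf_lt]
  rfl

/-- `IsUnitPoissonProcess` prescribes the law of a count only for finite volume. Truncating by
growing balls gives Poisson counts whose means tend to infinity, so the probability of fewer than
`n` points tends to `0` for every `n`. -/
lemma IsUnitPoissonProcess.ae_pointCount_eq_top (hy : IsUnitPoissonProcess μ y)
    {B : Set (EuclideanSpace ℝ (Fin d))} (hB : MeasurableSet B) (hv : volume B = ∞) :
    ∀ᵐ ω ∂μ, pointCount y B ω = ⊤ := by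
  have hfin : ∀ k : ℕ, volume (B ∩ Metric.closedBall 0 k) ≠ ∞ := fun k =>
    measure_ne_top_of_subset inter_subset_right measure_closedBall_lt_top.ne
  have hlim : Filter.Tendsto (fun k : ℕ => (volume (B ∩ Metric.closedBall 0 k)).toReal)
      Filter.atTop Filter.atTop := by
    have hmono : Monotone (fun k : ℕ => B ∩ Metric.closedBall (0 : EuclideanSpace ℝ (Fin d)) k) :=
      fun a b hab => inter_subset_inter_right _
        (Metric.closedBall_subset_closedBall (by exact_mod_cast hab))
    have h := tendsto_measure_iUnion_atTop (μ := volume) hmono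
    rw [← inter_iUnion, Metric.iUnion_closedBall_nat, inter_univ, hv] at h
    refine Filter.tendsto_atTop.2 fun b => ?_
    filter_upwards [h.eventually (lt_mem_nhds ENNReal.ofReal_lt_top)] with k hk
    exact (ENNReal.ofReal_le_iff_le_toReal (hfin k)).1 hk.le
  have hlt : ∀ n : ℕ, μ {ω | pointCount y B ω < n} = 0 := fun n => by
    have h0 : Filter.Tendsto (fun k : ℕ => μ {ω | pointCount y (B ∩ Metric.closedBall 0 k) ω < n})
        Filter.atTop (nhds 0) := by
      simp only [hy.measure_pointCount_lt (hB.inter measurableSet_closedBall) (hfin _)]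
      rw [← ENNReal.ofReal_zero]
      exact (ENNReal.continuous_ofReal.tendsto 0).comp ((tendsto_exp_neg_mul_sum n).comp hlim)
    refine le_antisymm (ge_of_tendsto' h0 fun k => measure_mono fun ω hω => ?_) zero_le
    exact lt_of_le_of_lt (encard_le_encard fun i hi => hi.1) hω
  have : ∀ᵐ ω ∂μ, ∀ n : ℕ, ¬ pointCount y B ω < n := ae_all_iff.2 fun n => by
    rw [ae_iff]; simpa using hlt n
  filter_upwards [this] with ω hω
  exact ENat.eq_top_iff_forall_ge.2 fun n => not_lt.1 (hω n)

/-- The law of the count depends only on the volume of the set. -/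
lemma IsUnitPoissonProcess.identDistrib_of_volume_eq [IsProbabilityMeasure μ]
    (hy : IsUnitPoissonProcess μ y)
    {A B : Set (EuclideanSpace ℝ (Fin d))} (hA : MeasurableSet A) (hB : MeasurableSet B)
    (h : volume A = volume B) : IdentDistrib (pointCount y A) (pointCount y B) μ μ := by
  by_cases hv : volume A = ∞
  -- For infinite volume both counts have the Dirac law at `⊤`.
  · exact (hasLaw_dirac_of_ae_eq (hy.ae_pointCount_eq_top hA hv)).identDistrib
      (hasLaw_dirac_of_ae_eq (hy.ae_pointCount_eq_top hB (h ▸ hv)))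
  · have hB' := hy.poisson B hB (h ▸ hv)
    rw [← h] at hB'
    exact (hy.poisson A hA hv).identDistrib hB'

/-- The intensity measure of a unit Poisson process is the volume. -/
lemma IsUnitPoissonProcess.sum_map_eq_volume (hy : IsUnitPoissonProcess μ y) :
    Measure.sum (fun i => μ.map (y i)) = volume := by
  have hfin : ∀ B : Set (EuclideanSpace ℝ (Fin d)), MeasurableSet B → volume B ≠ ∞ →
      Measure.sum (fun i => μ.map (y i)) B = volume B := fun B hB hv => by
    rw [← lintegral_pointCount μ hy.measurable hB,
      (hy.poisson B hB hv).lintegral_comp (f := fun k => (k : ℝ≥0∞))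
        Measurable.of_discrete.aemeasurable,
      lintegral_map .of_discrete (by fun_prop)]
    simp [lintegral_natCast_poissonMeasure, hv]
  -- Agreement is known only on sets of finite volume, so the space is exhausted by balls.
  refine Measure.ext_of_iUnion_eq_univ (s := fun k : ℕ => Metric.closedBall 0 (k : ℝ))
    (Metric.iUnion_closedBall_nat 0) fun k => ?_
  ext B hB
  rw [Measure.restrict_apply hB, Measure.restrict_apply hB]
  exact hfin _ (hB.inter measurableSet_closedBall)
    (measure_ne_top_of_subset inter_subset_right measure_closedBall_lt_top.ne)

lemma IsUnitPoissonProcess.iIndepFun_pointCount (hy : IsUnitPoissonProcess μ y) {ι : Type*}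
    [Fintype ι] (B : ι → Set (EuclideanSpace ℝ (Fin d))) (hB : ∀ j, MeasurableSet (B j))
    (hd : Pairwise fun j k => Disjoint (B j) (B k)) :
    iIndepFun (fun j => pointCount y (B j)) μ := by
  let e := Fintype.equivFin ι
  have h := hy.indep _ (fun j => B (e.symm j)) (fun j => hB _)
    (fun j k hjk => hd (e.symm.injective.ne hjk))
  simpa using h.precomp e.injective

/-! ### Joint laws of counts in overlapping sets. -/

/-- The set of points that belong to exactly those members of the family `A` whose index is in the
nonempty set `s`. -/
def atomOf {E : Type*} {n : ℕ} (A : Fin n → Set E) (s : Finset (Fin n)) : Set E :=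
  {z | s.Nonempty ∧ ∀ j, z ∈ A j ↔ j ∈ s}

lemma measurableSet_atomOf {E : Type*} [MeasurableSpace E] {n : ℕ} {A : Fin n → Set E}
    (hA : ∀ j, MeasurableSet (A j)) (s : Finset (Fin n)) : MeasurableSet (atomOf A s) := by
  have : atomOf A s = {_z | s.Nonempty} ∩ ⋂ j, {z | z ∈ A j ↔ j ∈ s} := by
    ext; simp [atomOf]
  rw [this]
  exact (MeasurableSet.const _).inter (.iInter fun j => (hA j).iff (.const _))

lemma disjoint_atomOf {E : Type*} {n : ℕ} (A : Fin n → Set E) :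
    Pairwise fun s t => Disjoint (atomOf A s) (atomOf A t) := fun s t hst => by
  refine Set.disjoint_left.2 fun z hs ht => hst ?_
  ext j
  rw [← hs.2 j, ht.2 j]

/-- The atoms whose index set contains `j` partition `A j`. This expresses counts in overlapping
sets through counts in disjoint ones, which are independent. -/
lemma pointCount_eq_sum_atomOf {Ω E : Type*} {n : ℕ} (p : ℕ+ → Ω → E) (A : Fin n → Set E)
    (j : Fin n) (ω : Ω) :
    pointCount p (A j) ω
      = ∑ s : Finset (Fin n), if j ∈ s then pointCount p (atomOf A s) ω else 0 := by
  classical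
  have hu : {i : ℕ+ | p i ω ∈ A j}
      = ⋃ s : Finset (Fin n), {i : ℕ+ | j ∈ s ∧ p i ω ∈ atomOf A s} := by
    ext i
    simp only [mem_ofPred_eq, mem_iUnion]
    -- The atom containing a point is indexed by all `k` whose set `A k` contains it.
    refine ⟨fun h => ⟨Finset.univ.filter fun k => p i ω ∈ A k, by simpa using h,
      ⟨j, by simpa using h⟩, fun k => by simp⟩, ?_⟩
    rintro ⟨s, hj, hs⟩
    exact (hs.2 j).2 hj
  have hdis : Pairwise (Function.onFun Disjoint
      fun s : Finset (Fin n) => {i : ℕ+ | j ∈ s ∧ p i ω ∈ atomOf A s}) := fun s t hst =>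
    Set.disjoint_left.2 fun i hi hi' =>
      Set.disjoint_left.1 (disjoint_atomOf A hst) hi.2 hi'.2
  rw [pointCount, hu, encard_iUnion_of_finite hdis, finsum_eq_sum_of_fintype]
  refine Finset.sum_congr rfl fun s _ => ?_
  by_cases h : j ∈ s <;> simp [h, pointCount]

/-- Two families of sets whose atoms have the same volumes have jointly identically distributed
counts. -/
lemma IsUnitPoissonProcess.identDistrib_of_volume_atomOf_eq [IsProbabilityMeasure μ]
    (hy : IsUnitPoissonProcess μ y)
    {n : ℕ} {A B : Fin n → Set (EuclideanSpace ℝ (Fin d))} (hA : ∀ j, MeasurableSet (A j))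
    (hB : ∀ j, MeasurableSet (B j)) (h : ∀ s, volume (atomOf A s) = volume (atomOf B s)) :
    IdentDistrib (fun ω j => pointCount y (A j) ω) (fun ω j => pointCount y (B j) ω) μ μ := by
  -- Independence over the disjoint atoms upgrades equality of the marginal laws to equality of the
  -- joint laws; the sums over atoms are then one fixed function of these vectors.
  have hat := IdentDistrib.pi (fun s => hy.identDistrib_of_volume_eq
      (measurableSet_atomOf hA s) (measurableSet_atomOf hB s) (h s))
    (hy.iIndepFun_pointCount _ (measurableSet_atomOf hA) (disjoint_atomOf A))
    (hy.iIndepFun_pointCount _ (measurableSet_atomOf hB) (disjoint_atomOf B))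
  have hu : Measurable (fun (v : Finset (Fin n) → ℕ∞) (j : Fin n) =>
      ∑ s : Finset (Fin n), if j ∈ s then v s else 0) :=
    Measurable.of_discrete
  have := hat.comp hu
  convert! this using 1
  · ext ω j; exact pointCount_eq_sum_atomOf y A j ω
  · ext ω j; exact pointCount_eq_sum_atomOf y B j ω

/-! ### Ball volumes and the Erlang law of the ordered points. -/

lemma ballConst_pos (d : ℕ) : 0 < ballConst d := by
  unfold ballConst; positivity

lemma volume_closedBall_eq_ballConst (hd : 0 < d) (x : EuclideanSpace ℝ (Fin d)) {r : ℝ}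
    (hr : 0 ≤ r) :
    volume (Metric.closedBall x r) = ENNReal.ofReal (ballConst d * r ^ d) := by
  have : Nonempty (Fin d) := ⟨⟨0, hd⟩⟩
  rw [EuclideanSpace.volume_closedBall, Fintype.card_fin, ← ENNReal.ofReal_pow hr,
    ← ENNReal.ofReal_mul (by positivity), ballConst, mul_comm, add_comm (1 : ℝ), Real.sqrt_eq_rpow,
    ← Real.rpow_natCast, ← Real.rpow_mul Real.pi_pos.le, one_div_mul_eq_div]

lemma volume_setOf_ballConst_mul_norm_pow_le (hd : 0 < d) {x : ℝ} (hx : 0 ≤ x) :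
    volume {z : EuclideanSpace ℝ (Fin d) | ballConst d * ‖z‖ ^ d ≤ x} = ENNReal.ofReal x := by
  have hc := ballConst_pos d
  -- The radius of the ball of volume `x`.
  set r : ℝ := (x / ballConst d) ^ ((d : ℝ)⁻¹) with hr
  have hr0 : 0 ≤ r := by positivity
  have hrd : r ^ d = x / ballConst d := Real.rpow_inv_natCast_pow (by positivity) hd.ne'
  have : {z : EuclideanSpace ℝ (Fin d) | ballConst d * ‖z‖ ^ d ≤ x} = Metric.closedBall 0 r := by
    ext z
    rw [mem_ofPred_eq, mem_closedBall_zero_iff, ← pow_le_pow_iff_left₀ (norm_nonneg z) hr0 hd.ne',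
      hrd, le_div_iff₀' hc]
  rw [this, volume_closedBall_eq_ballConst hd 0 hr0, hrd, mul_div_cancel₀ _ hc.ne']

/-- The volume of the ball through a point, as a function of the point, maps the volume to
Lebesgue measure on `(0,∞)`. -/
lemma hasLaw_ballConst_mul_norm_pow (hd : 0 < d) :
    HasLaw (fun z : EuclideanSpace ℝ (Fin d) => ballConst d * ‖z‖ ^ d)
      (posDensity fun _ => 1) volume := by
  have hm : Measurable (fun z : EuclideanSpace ℝ (Fin d) => ballConst d * ‖z‖ ^ d) := by fun_prop
  refine ⟨hm.aemeasurable, ?_⟩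
  have hval : ∀ x : ℝ, volume.map (fun z : EuclideanSpace ℝ (Fin d) => ballConst d * ‖z‖ ^ d)
      (Iic x) = ENNReal.ofReal x := fun x => by
    rw [Measure.map_apply hm measurableSet_Iic]
    rcases le_or_gt 0 x with hx | hx
    · exact volume_setOf_ballConst_mul_norm_pow_le hd hx
    · rw [ENNReal.ofReal_of_nonpos hx.le]
      refine measure_mono_null (t := ∅) (fun z hz => ?_) measure_empty
      have : 0 ≤ ballConst d * ‖z‖ ^ d := by have := ballConst_pos d; positivity
      exact absurd (lt_of_le_of_lt hz hx) (not_lt.2 this)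
  -- Both measures are infinite, so the half-lines `Iic n`, of finite measure, serve as the
  -- exhausting sequence for the π-system argument.
  refine Measure.ext_of_generateFrom_of_iUnion (range Iic) (fun n : ℕ => Iic (n : ℝ))
    (by rw [BorelSpace.measurable_eq (α := ℝ)]; exact borel_eq_generateFrom_Iic ℝ) isPiSystem_Iic
    ?_ (fun n => ⟨n, rfl⟩) (fun n => by simp [hval]) ?_
  · exact iUnion_Iic_of_not_bddAbove_range (by
      rw [not_bddAbove_iff]; intro x; obtain ⟨n, hn⟩ := exists_nat_gt x; exact ⟨n, ⟨n, rfl⟩, hn⟩)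
  · rintro _ ⟨x, rfl⟩
    rw [hval, posDensity_apply _ measurableSet_Iic, inter_comm, Ioi_inter_Iic]
    simp

/-- The volume of the ball through the `i`-th nearest point is Erlang distributed. -/
lemma hasLaw_ballConst_mul_nodeDist_pow [IsProbabilityMeasure μ] (hd : 0 < d)
    (hy : IsUnitPoissonProcess μ y) (hord : OrderedByDistance μ y) (i : ℕ+) :
    HasLaw (fun ω => ballConst d * nodeDist y i ω ^ d) (gammaMeasure (i : ℕ) 1) μ := by
  have hc := ballConst_pos d
  have hm : Measurable (fun ω => ballConst d * nodeDist y i ω ^ d) := by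
    have := hy.measurable i
    unfold nodeDist; fun_prop
  have hi : (0 : ℝ) < (i : ℕ) := by exact_mod_cast i.pos
  have := isProbabilityMeasure_gammaMeasure hi one_pos
  have := Measure.isProbabilityMeasure_map (μ := μ) hm.aemeasurable
  refine ⟨hm.aemeasurable, Measure.ext_of_Iic _ _ fun x => ?_⟩
  rcases lt_or_ge x 0 with hx | hx
  · rw [Measure.map_apply hm measurableSet_Iic, gammaMeasure_eq_posDensity,
      measure_mono_null (Iic_subset_Iic.2 hx.le) (posDensity_Iic_zero _)]
    refine measure_mono_null (t := ∅) (fun z hz => ?_) measure_empty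
    have : 0 ≤ ballConst d * nodeDist y i z ^ d := by unfold nodeDist; positivity
    exact absurd (lt_of_le_of_lt hz hx) (not_lt.2 this)
  have htail : μ.map (fun ω => ballConst d * nodeDist y i ω ^ d) (Ioi x)
      = gammaMeasure (i : ℕ) 1 (Ioi x) := by
    set A := {z : EuclideanSpace ℝ (Fin d) | ballConst d * ‖z‖ ^ d ≤ x} with hA
    have hAm : MeasurableSet A := measurableSet_le (by fun_prop) measurable_const
    have hv : volume A = ENNReal.ofReal x := volume_setOf_ballConst_mul_norm_pow_le hd hx
    -- The tail of shape `i` sums `k = 0, …, i - 1`, exactly the Poisson probabilities of fewer than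
    -- `i` points.
    obtain ⟨n, hn⟩ : ∃ n : ℕ, (i : ℕ) = n + 1 := ⟨_, (Nat.succ_pred_eq_of_pos i.pos).symm⟩
    have h1 := hy.measure_pointCount_lt hAm (by simp [hv]) (i : ℕ)
    rw [hv, ENNReal.toReal_ofReal hx] at h1
    rw [hn, gammaMeasure_Ioi n hx, ← hn, ← h1, Measure.map_apply hm measurableSet_Ioi]
    refine measure_congr ?_
    filter_upwards [hord] with ω hω
    refine propext ⟨fun h => ?_, fun h => ?_⟩
    · change pointCount y A ω < (i : ℕ)
      -- If the `i`-th point lies outside the ball, so do all later ones; only the `i - 1` smaller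
      -- indices can contribute.
      have hsub : {j : ℕ+ | y j ω ∈ A} ⊆ ((Finset.Iio i : Finset ℕ+) : Set ℕ+) := fun j hj => by
        simp only [Finset.coe_Iio, mem_Iio]
        by_contra hji
        have h2 : ‖y i ω‖ ≤ ‖y j ω‖ := hω (not_lt.1 hji)
        have h3 : ballConst d * ‖y i ω‖ ^ d ≤ ballConst d * ‖y j ω‖ ^ d := by gcongr
        exact absurd (h3.trans hj) (not_le.2 h)
      refine (encard_le_encard hsub).trans_lt ?_
      rw [encard_coe_eq_coe_finsetCard]
      have : (Finset.Iio i).card < (i : ℕ) := by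
        have h4 := PNat.card_Icc 1 i
        have h5 : (Finset.Iio i).card < (Finset.Icc 1 i).card := by
          refine Finset.card_lt_card (Finset.ssubset_iff_subset_ne.2 ⟨fun j hj => ?_, fun h => ?_⟩)
          · simp only [Finset.mem_Iio] at hj
            simp [hj.le]
          · have : i ∈ Finset.Iio i := by rw [h]; simp
            simp at this
        simpa [h4] using h5
      exact_mod_cast this
    · change x < ballConst d * nodeDist y i ω ^ d
      by_contra hle
      rw [not_lt] at hle
      -- If the `i`-th point lies in the ball, so do all earlier ones, giving at least `i` points.
      have hsub : ((Finset.Icc 1 i : Finset ℕ+) : Set ℕ+) ⊆ {j : ℕ+ | y j ω ∈ A} := fun j hj => by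
        have h2 : ‖y j ω‖ ≤ ‖y i ω‖ := hω (by simpa using hj)
        have h3 : ballConst d * ‖y j ω‖ ^ d ≤ ballConst d * ‖y i ω‖ ^ d := by gcongr
        exact h3.trans hle
      have h6 := encard_le_encard hsub
      rw [encard_coe_eq_coe_finsetCard, PNat.card_Icc] at h6
      simp only [add_tsub_cancel_right, PNat.one_coe] at h6
      exact absurd h (not_lt.2 h6)
  rw [← compl_Ioi, prob_compl_eq_one_sub measurableSet_Ioi, prob_compl_eq_one_sub measurableSet_Ioi,
    htail]

end Poisson

lemma hasLaw_posDensity_congr {S : Type*} [MeasurableSpace S] {P : Measure S} {X : S → ℝ}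
    {g g' : ℝ → ℝ} (h : HasLaw X (posDensity g) P) (H : ∀ x, 0 < x → g x = g' x) :
    HasLaw X (posDensity g') P :=
  posDensity_congr H ▸ h

/-! ### Path losses without fading. -/

section PathLoss

variable {Ω : Type*} [MeasurableSpace Ω] {μ : Measure Ω} {d : ℕ} {α δ : ℝ}
  {y : ℕ+ → Ω → EuclideanSpace ℝ (Fin d)}

lemma rpow_rpow_eq_pow (hα : 0 < α) (hδ : δ = (d : ℝ) / α) {r : ℝ} (hr : 0 ≤ r) :
    (r ^ α) ^ δ = r ^ d := by
  rw [← Real.rpow_mul hr, hδ, mul_div_cancel₀ _ hα.ne', Real.rpow_natCast]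

lemma measurable_pathLoss (hy : ∀ i, Measurable (y i)) (i : ℕ+) :
    Measurable (pathLoss α y i) := by
  have := hy i
  unfold pathLoss nodeDist
  fun_prop

lemma pathLoss_nonneg {Ω : Type*} (y : ℕ+ → Ω → EuclideanSpace ℝ (Fin d)) (i : ℕ+) (ω : Ω) :
    0 ≤ pathLoss α y i ω :=
  Real.rpow_nonneg (norm_nonneg _) _

/-- Moments of `x_i` thereby become fractional moments of the Erlang variable `c * x_i ^ δ`. -/
lemma pathLoss_eq_mul_rpow {Ω : Type*} (hd : 0 < d) (hα : 0 < α) (hδ : δ = (d : ℝ) / α)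
    (y : ℕ+ → Ω → EuclideanSpace ℝ (Fin d)) (i : ℕ+) (ω : Ω) :
    pathLoss α y i ω
      = ballConst d ^ (-(1 / δ)) * (ballConst d * pathLoss α y i ω ^ δ) ^ (1 / δ) := by
  have hδ0 : 0 < δ := by rw [hδ]; positivity
  have hc := ballConst_pos d
  have hp := pathLoss_nonneg (α := α) y i ω
  rw [Real.mul_rpow hc.le (by positivity), ← Real.rpow_mul hp, mul_one_div_cancel hδ0.ne',
    Real.rpow_one, ← mul_assoc, ← Real.rpow_add hc, neg_add_cancel, Real.rpow_zero, one_mul]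

/-- The law of `‖z‖ ^ α` under the volume. -/
lemma hasLaw_norm_rpow (hd : 0 < d) (hα : 0 < α) (hδ : δ = (d : ℝ) / α) :
    HasLaw (fun z : EuclideanSpace ℝ (Fin d) => ‖z‖ ^ α)
      (posDensity fun x => ballConst d * δ * x ^ (δ - 1)) volume := by
  have hδ0 : 0 < δ := by rw [hδ]; positivity
  have h := hasLaw_ballConst_mul_norm_pow hd
  simp only [← rpow_rpow_eq_pow hα hδ (norm_nonneg _)] at h
  simpa using hasLaw_posDensity_of_mul_rpow (by fun_prop)
    (fun z => Real.rpow_nonneg (norm_nonneg z) α) (ballConst_pos d) hδ0 h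

/-- Counting path losses in `B` is counting points in the preimage of `B`, and the mean count of
points is the volume. -/
lemma IsUnitPoissonProcess.meanCount_pathLoss (hy : IsUnitPoissonProcess μ y) {B : Set ℝ}
    (hB : MeasurableSet B) :
    meanCount μ (pathLoss α y) B
      = volume ((fun z : EuclideanSpace ℝ (Fin d) => ‖z‖ ^ α) ⁻¹' B) := by
  have hg : Measurable fun z : EuclideanSpace ℝ (Fin d) => ‖z‖ ^ α := by fun_prop
  rw [← hy.sum_map_eq_volume, ← lintegral_pointCount μ hy.measurable (hg hB)]
  rfl

lemma IsUnitPoissonProcess.meanCount_pathLoss_eq_lintegral (hd : 0 < d) (hα : 0 < α)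
    (hδ : δ = (d : ℝ) / α) (hy : IsUnitPoissonProcess μ y) {B : Set ℝ} (hB : MeasurableSet B) :
    meanCount μ (pathLoss α y) B
      = ∫⁻ x in B ∩ Ioi 0, ENNReal.ofReal (ballConst d * δ * x ^ (δ - 1)) := by
  rw [hy.meanCount_pathLoss hB, ← posDensity_apply _ hB]
  exact (hasLaw_norm_rpow hd hα hδ).measure_eq (p := fun t => t ∈ B) hB

lemma IsUnitPoissonProcess.meanCount_pathLoss_Ico (hd : 0 < d) (hα : 0 < α)
    (hδ : δ = (d : ℝ) / α) (hy : IsUnitPoissonProcess μ y) {x : ℝ} (hx : 0 ≤ x) :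
    meanCount μ (pathLoss α y) (Ico 0 x) = ENNReal.ofReal (ballConst d * x ^ δ) := by
  have hδ0 : 0 < δ := by rw [hδ]; positivity
  have hset : (fun z : EuclideanSpace ℝ (Fin d) => ‖z‖ ^ α) ⁻¹' (Ico 0 x)
      = {z | ballConst d * ‖z‖ ^ d ∈ Iio (ballConst d * x ^ δ)} := by
    ext z
    have hz : 0 ≤ ‖z‖ ^ α := Real.rpow_nonneg (norm_nonneg z) α
    rw [mem_preimage, mem_Ico, mem_ofPred_eq, mem_Iio, mul_lt_mul_iff_right₀ (ballConst_pos d),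
      ← rpow_rpow_eq_pow hα hδ (norm_nonneg z), Real.rpow_lt_rpow_iff hz hx hδ0]
    exact and_iff_right hz
  rw [hy.meanCount_pathLoss measurableSet_Ico, hset,
    (hasLaw_ballConst_mul_norm_pow hd).measure_eq (p := fun t => t ∈ Iio _) measurableSet_Iio]
  change posDensity (fun _ => 1) (Iio _) = _
  rw [posDensity_apply _ measurableSet_Iio, inter_comm, Ioi_inter_Iio]
  simp

lemma IsUnitPoissonProcess.hasDerivAt_meanCount_pathLoss (hd : 0 < d) (hα : 0 < α)
    (hδ : δ = (d : ℝ) / α) (hy : IsUnitPoissonProcess μ y) {x : ℝ} (hx : 0 < x) :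
    HasDerivAt (fun a : ℝ => (meanCount μ (pathLoss α y) (Ico 0 a)).toReal)
      (ballConst d * δ * x ^ (δ - 1)) x := by
  have h := (Real.hasDerivAt_rpow_const (p := δ) (Or.inl hx.ne')).const_mul (ballConst d)
  rw [← mul_assoc] at h
  refine h.congr_of_eventuallyEq ?_
  filter_upwards [lt_mem_nhds hx] with a ha
  have := ballConst_pos d
  rw [hy.meanCount_pathLoss_Ico hd hα hδ ha.le, ENNReal.toReal_ofReal (by positivity)]

lemma atomOf_preimage {E E' : Type*} {n : ℕ} (g : E → E') (B : Fin n → Set E')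
    (s : Finset (Fin n)) : atomOf (fun j => g ⁻¹' (B j)) s = g ⁻¹' (atomOf B s) := rfl

lemma atomOf_image_add_left {n : ℕ} (t : ℝ) (B : Fin n → Set ℝ) (s : Finset (Fin n)) :
    atomOf (fun j => (fun x => t + x) '' B j) s = (fun x => t + x) '' atomOf B s := by
  simp only [image_add_left]
  rfl

/-- The nonemptiness built into `atomOf` matters here: without it the empty index set would give the
complement of the union, which need not lie in `C`. -/
lemma atomOf_subset {E : Type*} {n : ℕ} {B : Fin n → Set E} {C : Set E} (h : ∀ j, B j ⊆ C)
    (s : Finset (Fin n)) : atomOf B s ⊆ C := by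
  rintro z ⟨⟨j, hj⟩, hz⟩
  exact h j ((hz j).2 hj)

lemma IsUnitPoissonProcess.isStationaryOnHalfLine_pathLoss [IsProbabilityMeasure μ] (hd : 0 < d)
    (hα : 0 < α) (hδ : 1 = (d : ℝ) / α) (hy : IsUnitPoissonProcess μ y) :
    IsStationaryOnHalfLine μ (pathLoss α y) := by
  intro t ht n B hB hB0
  have hg : Measurable fun z : EuclideanSpace ℝ (Fin d) => ‖z‖ ^ α := by fun_prop
  -- With `δ = 1` the density is the constant `ballConst d`; the endpoint `0`, which `posDensity`
  -- omits, is null.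
  have hvol : ∀ C : Set ℝ, MeasurableSet C → C ⊆ Ici 0 →
      volume ((fun z : EuclideanSpace ℝ (Fin d) => ‖z‖ ^ α) ⁻¹' C)
        = ENNReal.ofReal (ballConst d) * volume C := fun C hC hC0 => by
    have h := (hasLaw_norm_rpow hd hα hδ).measure_eq (p := fun t => t ∈ C) hC
    have hae : (C ∩ Ioi 0 : Set ℝ) =ᵐ[volume] C := by
      have := ae_eq_set_inter (Filter.EventuallyEq.refl (ae volume) C)
        (Ioi_ae_eq_Ici (a := (0 : ℝ)) (μ := volume))
      rwa [inter_eq_left.2 hC0] at this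
    refine h.trans ((posDensity_apply _ hC).trans ?_)
    simp [measure_congr hae]
  have himg : ∀ C : Set ℝ, MeasurableSet C → MeasurableSet ((fun s => t + s) '' C) :=
    fun C hC => (measurableEmbedding_addLeft t).measurableSet_image.2 hC
  refine hy.identDistrib_of_volume_atomOf_eq
    (A := fun j => (fun z : EuclideanSpace ℝ (Fin d) => ‖z‖ ^ α) ⁻¹' ((fun s => t + s) '' B j))
    (B := fun j => (fun z : EuclideanSpace ℝ (Fin d) => ‖z‖ ^ α) ⁻¹' (B j))
    (fun j => hg (himg _ (hB j))) (fun j => hg (hB j)) fun s => ?_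
  have hs := measurableSet_atomOf hB s
  have hs0 := atomOf_subset hB0 s
  rw [atomOf_preimage, atomOf_preimage, atomOf_image_add_left, hvol _ hs hs0,
    hvol _ (himg _ hs)]
  · simp only [image_add_left, measure_preimage_add]
  · rintro _ ⟨z, hz, rfl⟩
    exact add_nonneg ht (hs0 hz)

section Laws

variable [IsProbabilityMeasure μ] (hd : 0 < d) (hα : 0 < α) (hδ : δ = (d : ℝ) / α)
  (hy : IsUnitPoissonProcess μ y) (hord : OrderedByDistance μ y) (i : ℕ+)

include hd hy hord in
lemma hasDensityOnPos_nodeDist :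
    HasDensityOnPos μ (nodeDist y i) (fun r => Real.exp (-(ballConst d * r ^ d))
      * ((d : ℝ) * (ballConst d * r ^ d) ^ (i : ℕ) / (r * Real.Gamma (i : ℕ)))) := by
  have h := hasLaw_ballConst_mul_nodeDist_pow hd hy hord i
  simp only [← Real.rpow_natCast _ d] at h
  rw [gammaMeasure_eq_posDensity] at h
  have hm : Measurable (nodeDist y i) := by
    have := hy.measurable i
    unfold nodeDist; fun_prop
  have h' := hasLaw_posDensity_of_mul_rpow hm (fun ω => norm_nonneg _) (ballConst_pos d)
    (by exact_mod_cast hd) h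
  refine hasLaw_posDensity_congr h' fun x hx => ?_
  have hc := ballConst_pos d
  have hxd : x ^ ((d : ℝ) - 1) = x ^ d / x := by
    rw [Real.rpow_sub_one hx.ne', Real.rpow_natCast]
  rw [Real.one_rpow, hxd, Real.rpow_sub_one (by positivity), Real.rpow_natCast, Real.rpow_natCast]
  have : Real.Gamma (i : ℕ) ≠ 0 := (Real.Gamma_pos_of_pos (by exact_mod_cast i.pos)).ne'
  field_simp

include hd hα hδ hy hord

/-- Because `α * δ = d`, this is the ball volume `T (y i)` again. -/
lemma hasLaw_ballConst_mul_pathLoss_rpow :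
    HasLaw (fun ω => ballConst d * pathLoss α y i ω ^ δ) (gammaMeasure (i : ℕ) 1) μ := by
  have h := hasLaw_ballConst_mul_nodeDist_pow hd hy hord i
  simp only [nodeDist, ← rpow_rpow_eq_pow hα hδ (norm_nonneg _)] at h
  exact h

lemma hasLaw_pathLoss :
    HasLaw (pathLoss α y i) (posDensity fun r => ballConst d ^ (i : ℕ) * δ
      * r ^ (δ * (i : ℕ) - 1) * Real.exp (-(ballConst d * r ^ δ)) / Real.Gamma (i : ℕ)) μ := by
  have hδ0 : 0 < δ := by rw [hδ]; positivity
  have h := hasLaw_ballConst_mul_pathLoss_rpow hd hα hδ hy hord i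
  rw [gammaMeasure_eq_posDensity] at h
  have h' := hasLaw_posDensity_of_mul_rpow (measurable_pathLoss hy.measurable i)
    (pathLoss_nonneg y i) (ballConst_pos d) hδ0 h
  refine hasLaw_posDensity_congr h' fun x hx => ?_
  have hc := ballConst_pos d
  have h1 : x ^ (δ * (i : ℕ) - 1) = (x ^ δ) ^ (i : ℕ) / x := by
    rw [Real.rpow_sub_one hx.ne', Real.rpow_mul hx.le, Real.rpow_natCast]
  rw [h1, Real.one_rpow, Real.rpow_sub_one hx.ne', Real.rpow_sub_one (by positivity),
    Real.rpow_natCast]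
  have : Real.Gamma (i : ℕ) ≠ 0 := (Real.Gamma_pos_of_pos (by exact_mod_cast i.pos)).ne'
  field_simp
  ring

lemma cdf_pathLoss {x : ℝ} (hx : 0 ≤ x) :
    cdf (μ.map (pathLoss α y i)) x
      = 1 - upperGamma (i : ℕ) (ballConst d * x ^ δ) / Real.Gamma (i : ℕ) := by
  have hδ0 : 0 < δ := by rw [hδ]; positivity
  have hc := ballConst_pos d
  have hi : (0 : ℝ) < (i : ℕ) := by exact_mod_cast i.pos
  have hm := measurable_pathLoss (α := α) hy.measurable i
  have := Measure.isProbabilityMeasure_map (μ := μ) hm.aemeasurable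
  have := isProbabilityMeasure_gammaMeasure hi one_pos
  have h := (hasLaw_ballConst_mul_pathLoss_rpow hd hα hδ hy hord i).measureReal_eq
    (p := fun t => t ≤ ballConst d * x ^ δ) measurableSet_Iic
  rw [cdf_eq_real, map_measureReal_apply hm measurableSet_Iic,
    ← gammaMeasure_one_real_Ioi hi (by positivity), ← probReal_compl_eq_one_sub measurableSet_Ioi,
    compl_Ioi]
  refine Eq.trans ?_ h
  congr 1
  ext ω
  rw [mem_preimage, mem_Iic, mem_ofPred_eq, mul_le_mul_iff_right₀ hc,
    Real.rpow_le_rpow_iff (pathLoss_nonneg y i ω) hx hδ0]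

omit hd hα hδ hord in
lemma cdf_pathLoss_of_neg {x : ℝ} (hx : x < 0) : cdf (μ.map (pathLoss α y i)) x = 0 := by
  have hm := measurable_pathLoss (α := α) hy.measurable i
  have := Measure.isProbabilityMeasure_map (μ := μ) hm.aemeasurable
  rw [cdf_eq_real, map_measureReal_apply hm measurableSet_Iic]
  convert! measureReal_empty (μ := μ) using 2
  exact eq_empty_of_forall_notMem fun ω hω =>
    absurd (lt_of_le_of_lt hω hx) (not_lt.2 (pathLoss_nonneg y i ω))

lemma integrable_pathLoss : Integrable (pathLoss α y i) μ := by
  have hδ0 : 0 < δ := by rw [hδ]; positivity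
  have hi : (0 : ℝ) < (i : ℕ) := by exact_mod_cast i.pos
  have h := hasLaw_ballConst_mul_pathLoss_rpow hd hα hδ hy hord i
  have hint := integrable_rpow_gammaMeasure (s := 1 / δ) hi one_pos (by positivity)
  rw [← h.map_eq] at hint
  have := (hint.comp_aemeasurable h.aemeasurable).const_mul (ballConst d ^ (-(1 / δ)))
  refine this.congr (Filter.Eventually.of_forall fun ω => ?_)
  exact (pathLoss_eq_mul_rpow hd hα hδ y i ω).symm

lemma integral_pathLoss :
    ∫ ω, pathLoss α y i ω ∂μ = ballConst d ^ (-(1 / δ))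
      * (Real.Gamma ((i : ℕ) + 1 / δ) / Real.Gamma (i : ℕ)) := by
  have hδ0 : 0 < δ := by rw [hδ]; positivity
  have hi : (0 : ℝ) < (i : ℕ) := by exact_mod_cast i.pos
  have h := hasLaw_ballConst_mul_pathLoss_rpow hd hα hδ hy hord i
  have h1 := h.integral_comp (f := fun t => t ^ (1 / δ))
    (by fun_prop)
  rw [integral_rpow_gammaMeasure hi one_pos (by positivity), Real.one_rpow, mul_one] at h1
  rw [integral_congr_ae (Filter.Eventually.of_forall (pathLoss_eq_mul_rpow hd hα hδ y i)),
    integral_const_mul, ← h1]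
  rfl

omit hδ in
lemma hasLaw_pathLoss_gammaMeasure (hδ : 1 = (d : ℝ) / α) :
    HasLaw (pathLoss α y i) (gammaMeasure (i : ℕ) (ballConst d)) μ := by
  have h := hasLaw_pathLoss hd hα hδ hy hord i
  rw [gammaMeasure_eq_posDensity]
  refine hasLaw_posDensity_congr h fun x hx => ?_
  rw [Real.rpow_one, one_mul, Real.rpow_natCast]
  ring

end Laws

end PathLoss

/-! ### Quotients of independent random variables. -/

section Ratio

variable {Ω : Type*} [MeasurableSpace Ω] {μ : Measure Ω} {X F : Ω → ℝ} {ρ ν : Measure ℝ}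

lemma extCdf_ofReal_div_of_nonpos (hX : ∀ᵐ ω ∂μ, 0 < X ω) {x : ℝ} (hx : x ≤ 0) :
    extCdf μ (fun ω => ENNReal.ofReal (X ω) / ENNReal.ofReal (F ω)) x = 0 := by
  have : μ {ω | ((ENNReal.ofReal (X ω) / ENNReal.ofReal (F ω) : ℝ≥0∞) : EReal) ≤ (x : EReal)}
      = 0 := by
    refine measure_mono_null (fun ω hω => ?_) (ae_iff.1 hX)
    have h0 : ((ENNReal.ofReal (X ω) / ENNReal.ofReal (F ω) : ℝ≥0∞) : EReal) ≤ 0 :=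
      le_trans hω (by exact_mod_cast hx)
    have h1 : ENNReal.ofReal (X ω) / ENNReal.ofReal (F ω) = 0 := by
      exact le_antisymm (EReal.coe_ennreal_le_coe_ennreal_iff.1 (by simpa using h0)) zero_le
    simpa [ENNReal.div_eq_zero_iff] using h1
  rw [extCdf, measureReal_def, this, ENNReal.toReal_zero]

/-- No sign condition on `b` is needed: for `b ≤ 0` the quotient is `∞` and `x * b ≤ 0 < a`, so both
sides fail. -/
lemma ofReal_div_ofReal_le_iff {a b x : ℝ} (ha : 0 < a) (hx : 0 < x) :
    ((ENNReal.ofReal a / ENNReal.ofReal b : ℝ≥0∞) : EReal) ≤ (x : EReal) ↔ a ≤ x * b := by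
  have : (x : EReal) = ((ENNReal.ofReal x : ℝ≥0∞) : EReal) := by
    rw [EReal.coe_ennreal_ofReal, max_eq_left hx.le]
  rw [this, EReal.coe_ennreal_le_coe_ennreal_iff]
  rcases le_or_gt b 0 with hb | hb
  · rw [ENNReal.ofReal_of_nonpos hb, ENNReal.div_zero (by simpa using ha)]
    have : x * b ≤ 0 := mul_nonpos_of_nonneg_of_nonpos hx.le hb
    simp only [top_le_iff, ENNReal.ofReal_ne_top, false_iff, not_le]
    linarith
  · rw [← ENNReal.ofReal_div_of_pos hb, ENNReal.ofReal_le_ofReal_iff hx.le, div_le_iff₀ hb]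

lemma measurable_cdf_div (ν : Measure ℝ) (x : ℝ) : Measurable fun r => cdf ν (r / x) :=
  (monotone_cdf ν).measurable.comp (by fun_prop)

lemma integrable_cdf_div (ρ ν : Measure ℝ) [IsFiniteMeasure ρ] (x : ℝ) :
    Integrable (fun r => cdf ν (r / x)) ρ :=
  Integrable.of_bound (measurable_cdf_div ν x).aestronglyMeasurable 1
    (Filter.Eventually.of_forall fun r => by
      rw [Real.norm_of_nonneg (cdf_nonneg ν _)]; exact cdf_le_one ν _)

/-- The complement of `X ≤ x F` is `F < X / x`. Ties are null because `ρ` has no atoms, so the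
strict inequality may be relaxed to `F ≤ X / x`; integrating over `X` first fixed then yields `cdf ν
(r / x)`. -/
lemma extCdf_ofReal_div_eq [IsProbabilityMeasure μ] (hX : HasLaw X ρ μ) (hF : HasLaw F ν μ)
    (hind : IndepFun X F μ) [NullSingletonClass ρ] (hX0 : ∀ᵐ ω ∂μ, 0 < X ω) {x : ℝ}
    (hx : 0 < x) :
    extCdf μ (fun ω => ENNReal.ofReal (X ω) / ENNReal.ofReal (F ω)) x
      = 1 - ∫ r, cdf ν (r / x) ∂ρ := by
  have := hX.isProbabilityMeasure_iff.1 inferInstance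
  have := hF.isProbabilityMeasure_iff.1 inferInstance
  have hXF := (indepFun_iff_hasLaw_prodMk_prod hX hF).1 hind
  have hm1 : MeasurableSet {p : ℝ × ℝ | x * p.2 = p.1} :=
    measurableSet_eq_fun (by fun_prop) (by fun_prop)
  have hm2 : MeasurableSet {p : ℝ × ℝ | p.1 ≤ x * p.2} :=
    measurableSet_le (by fun_prop) (by fun_prop)
  have hm3 : MeasurableSet {p : ℝ × ℝ | x * p.2 ≤ p.1} :=
    measurableSet_le (by fun_prop) (by fun_prop)
  -- For each value `s` of `F`, the only tie is the single point `x * s`.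
  have hnull : (ρ.prod ν) {p : ℝ × ℝ | x * p.2 = p.1} = 0 := by
    rw [Measure.prod_apply_symm hm1]
    have : ∀ s : ℝ, (fun r : ℝ => (r, s)) ⁻¹' {p : ℝ × ℝ | x * p.2 = p.1} = {x * s} := by
      intro s; ext r; simp [eq_comm]
    simp [this]
  have hcompl : (ρ.prod ν) {p : ℝ × ℝ | p.1 ≤ x * p.2}ᶜ
      = (ρ.prod ν) {p : ℝ × ℝ | x * p.2 ≤ p.1} := by
    refine measure_congr ?_
    filter_upwards [measure_eq_zero_iff_ae_notMem.1 hnull] with p hp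
    refine propext ⟨fun h => (not_le.1 (mem_compl_iff _ _ |>.1 h)).le, fun h => ?_⟩
    exact (not_le.2 (lt_of_le_of_ne h hp) : ¬ p.1 ≤ x * p.2)
  have hmain : (ρ.prod ν).real {p : ℝ × ℝ | x * p.2 ≤ p.1} = ∫ r, cdf ν (r / x) ∂ρ := by
    rw [measureReal_def, Measure.prod_apply hm3, ← integral_toReal
      (measurable_measure_prodMk_left hm3).aemeasurable
      (Filter.Eventually.of_forall fun _ => measure_lt_top _ _)]
    refine integral_congr_ae (Filter.Eventually.of_forall fun r => ?_)
    simp only [cdf_eq_real, measureReal_def]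
    congr 2
    ext s
    simp [le_div_iff₀' hx]
  have hset : extCdf μ (fun ω => ENNReal.ofReal (X ω) / ENNReal.ofReal (F ω)) x
      = μ.real {ω | X ω ≤ x * F ω} := by
    refine measureReal_congr ?_
    filter_upwards [hX0] with ω hω
    exact propext (ofReal_div_ofReal_le_iff hω hx)
  rw [hset, hXF.measureReal_eq (p := fun p => p.1 ≤ x * p.2) hm2, ← hmain,
    measureReal_def _ {p : ℝ × ℝ | x * p.2 ≤ p.1}, ← hcompl, ← measureReal_def,
    probReal_compl_eq_one_sub hm2, sub_sub_cancel]

lemma gammaMeasure_preimage_div {a c s : ℝ} (hs : 0 < s) {B : Set ℝ}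
    (hB : MeasurableSet B) :
    gammaMeasure a c ((fun x => x / s) ⁻¹' B)
      = ∫⁻ u in B ∩ Ioi 0, ENNReal.ofReal (s *
        (c ^ a / Real.Gamma a * (s * u) ^ (a - 1) * Real.exp (-(c * (s * u))))) := by
  have himg : (fun x => x / s) ⁻¹' B ∩ Ioi 0 = (fun u => s * u) '' (B ∩ Ioi 0) := by
    ext x
    constructor
    · rintro ⟨h1, h2⟩
      exact ⟨x / s, ⟨h1, div_pos h2 hs⟩, by field_simp⟩
    · rintro ⟨u, ⟨h1, h2⟩, rfl⟩
      exact ⟨by simpa [hs.ne'] using h1, mul_pos hs h2⟩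
  rw [gammaMeasure_eq_posDensity,
    posDensity_apply _ ((by fun_prop : Measurable fun x : ℝ => x / s) hB), himg,
    lintegral_image_eq_lintegral_abs_deriv_mul (hB.inter measurableSet_Ioi)
      (f' := fun _ => s) (fun u _ => by simpa using ((hasDerivAt_id u).const_mul s).hasDerivWithinAt)
      (fun u _ v _ h => mul_left_cancel₀ hs.ne' h)]
  refine lintegral_congr fun u => ?_
  rw [abs_of_pos hs, ← ENNReal.ofReal_mul hs.le]

/-- The ratio of independent gamma variables has a (scaled) beta prime distribution. -/
lemma hasLaw_div_of_gammaMeasure [IsProbabilityMeasure μ] {a b c r : ℝ} (ha : 0 < a) (hb : 0 < b)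
    (hc : 0 < c) (hr : 0 < r) (hX : HasLaw X (gammaMeasure a c) μ)
    (hF : HasLaw F (gammaMeasure b r) μ) (hind : IndepFun X F μ) :
    HasLaw (fun ω => X ω / F ω) (posDensity fun u =>
      c ^ a * r ^ b * Real.Gamma (a + b) / (Real.Gamma a * Real.Gamma b) * u ^ (a - 1)
        / (r + c * u) ^ (a + b)) μ := by
  have := isProbabilityMeasure_gammaMeasure ha hc
  have := isProbabilityMeasure_gammaMeasure hb hr
  have hXF := (indepFun_iff_hasLaw_prodMk_prod hX hF).1 hind
  have hXFm : AEMeasurable (fun ω => X ω / F ω) μ := hX.aemeasurable.div hF.aemeasurable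
  refine ⟨hXFm, ?_⟩
  ext B hB
  have hm : MeasurableSet {p : ℝ × ℝ | p.1 / p.2 ∈ B} :=
    (measurable_fst.div measurable_snd) hB
  have hΓa := Real.Gamma_pos_of_pos ha
  have hΓb := Real.Gamma_pos_of_pos hb
  rw [Measure.map_apply_of_aemeasurable hXFm hB]
  refine (hXF.measure_eq (p := fun p => p.1 / p.2 ∈ B) hm).trans ?_
  rw [Measure.prod_apply_symm hm]
  -- Condition on the denominator `s`: only its law is expanded here, and the numerator is rescaled
  -- by `s`.
  conv_lhs => rw [gammaMeasure_eq_posDensity b r]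
  rw [posDensity, lintegral_withDensity_eq_lintegral_mul _ (by fun_prop)
    (measurable_measure_prodMk_right hm), posDensity_apply _ hB]
  have h1 : ∀ s ∈ Ioi (0 : ℝ), ((fun t => ENNReal.ofReal (r ^ b / Real.Gamma b * t ^ (b - 1)
        * Real.exp (-(r * t)))) * fun s => gammaMeasure a c
          ((fun x => (x, s)) ⁻¹' {p : ℝ × ℝ | p.1 / p.2 ∈ B})) s
      = ∫⁻ u in B ∩ Ioi 0, ENNReal.ofReal (r ^ b / Real.Gamma b * s ^ (b - 1)
        * Real.exp (-(r * s)) * (s *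
        (c ^ a / Real.Gamma a * (s * u) ^ (a - 1) * Real.exp (-(c * (s * u)))))) := fun s hs => by
    rw [Pi.mul_apply]
    have h2 := gammaMeasure_preimage_div (a := a) (c := c) hs hB
    change _ * gammaMeasure a c ((fun x => x / s) ⁻¹' B) = _
    rw [h2, ← lintegral_const_mul _ (by fun_prop)]
    refine lintegral_congr fun u => ?_
    rw [← ENNReal.ofReal_mul (gamma_density_nonneg hb hr s hs)]
  rw [setLIntegral_congr_fun measurableSet_Ioi h1, lintegral_lintegral_swap (by fun_prop)]
  refine setLIntegral_congr_fun (hB.inter measurableSet_Ioi) fun u hu => ?_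
  have hu0 : 0 < u := hu.2
  -- After Tonelli, the integrand in `s` is an unnormalised gamma density of shape `a + b` and rate
  -- `r + c * u`.
  have h3 : ∀ s ∈ Ioi (0 : ℝ), ENNReal.ofReal (r ^ b / Real.Gamma b * s ^ (b - 1)
        * Real.exp (-(r * s)) * (s *
        (c ^ a / Real.Gamma a * (s * u) ^ (a - 1) * Real.exp (-(c * (s * u))))))
      = ENNReal.ofReal (r ^ b / Real.Gamma b * (c ^ a / Real.Gamma a) * u ^ (a - 1))
        * ENNReal.ofReal (s ^ (a + b - 1) * Real.exp (-((r + c * u) * s))) := fun s hs => by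
    have hs0 : 0 < s := hs
    rw [← ENNReal.ofReal_mul (by positivity)]
    congr 1
    have e1 : s ^ (a + b - 1) = s ^ (b - 1) * s * s ^ (a - 1) := by
      rw [← Real.rpow_add_one hs0.ne', ← Real.rpow_add hs0]; ring_nf
    have e2 : Real.exp (-((r + c * u) * s)) = Real.exp (-(r * s)) * Real.exp (-(c * (s * u))) := by
      rw [← Real.exp_add]; ring_nf
    rw [e1, e2, Real.mul_rpow hs0.le hu0.le]
    ring
  rw [setLIntegral_congr_fun measurableSet_Ioi h3, lintegral_const_mul _ (by fun_prop),
    lintegral_rpow_mul_exp_neg_mul (by positivity) (by positivity),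
    ← ENNReal.ofReal_mul (by positivity)]
  congr 1
  field_simp

/-- The Laplace transform of the gamma distribution. -/
lemma integral_exp_neg_mul_gammaMeasure {a r s : ℝ} (ha : 0 < a) (hr : 0 < r) (hs : 0 ≤ s) :
    ∫ t, Real.exp (-(s * t)) ∂(gammaMeasure a r) = (r / (r + s)) ^ a := by
  rw [gammaMeasure_eq_posDensity,
    integral_posDensity (by fun_prop) (gamma_density_nonneg ha hr)]
  have h : ∀ x : ℝ, Real.exp (-(s * x))
      * (r ^ a / Real.Gamma a * x ^ (a - 1) * Real.exp (-(r * x)))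
      = r ^ a / Real.Gamma a * (x ^ (a - 1) * Real.exp (-((r + s) * x))) := fun x => by
    have : Real.exp (-((r + s) * x)) = Real.exp (-(r * x)) * Real.exp (-(s * x)) := by
      rw [← Real.exp_add]; ring_nf
    rw [this]; ring
  simp only [h]
  rw [integral_const_mul, Real.integral_rpow_mul_exp_neg_mul_Ioi ha (by positivity),
    Real.div_rpow hr.le (by positivity), one_div, Real.inv_rpow (by positivity)]
  have := (Real.Gamma_pos_of_pos ha).ne'
  field_simp

lemma integrable_exp_neg_mul_gammaMeasure {a r s : ℝ} (ha : 0 < a) (hr : 0 < r) (hs : 0 ≤ s) :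
    Integrable (fun t => Real.exp (-(s * t))) (gammaMeasure a r) := by
  have := isProbabilityMeasure_gammaMeasure ha hr
  -- A non-integrable function has Bochner integral `0`, whereas the value computed above is
  -- positive.
  by_contra h
  have h1 := integral_exp_neg_mul_gammaMeasure ha hr hs
  rw [integral_undef h] at h1
  have : 0 < (r / (r + s)) ^ a := by positivity
  linarith

lemma ae_pos_of_hasLaw_gammaMeasure {a r : ℝ} (h : HasLaw X (gammaMeasure a r) μ) :
    ∀ᵐ ω ∂μ, 0 < X ω := by
  rw [gammaMeasure_eq_posDensity] at h
  exact ae_pos_of_hasLaw_posDensity h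

lemma toReal_ofReal_div_ofReal {a b : ℝ} (ha : 0 < a) (hb : 0 < b) :
    (ENNReal.ofReal a / ENNReal.ofReal b).toReal = a / b := by
  rw [ENNReal.toReal_div, ENNReal.toReal_ofReal ha.le, ENNReal.toReal_ofReal hb.le]

/-- The moments of a ratio of independent gamma variables. -/
lemma moment_div_of_gammaMeasure {a b c r : ℝ} (ha : 0 < a) (hb : 0 < b)
    (hc : 0 < c) (hr : 0 < r) (hX : HasLaw X (gammaMeasure a c) μ)
    (hF : HasLaw F (gammaMeasure b r) μ) (hind : IndepFun X F μ) (k : ℕ) (hk : k < b) :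
    Integrable (fun ω => (X ω / F ω) ^ k) μ ∧
      ∫ ω, (X ω / F ω) ^ k ∂μ = Real.Gamma (a + k) / (Real.Gamma a * c ^ k)
        * (Real.Gamma (b - k) * r ^ k / Real.Gamma b) := by
  have hX0 := ae_pos_of_hasLaw_gammaMeasure hX
  have hF0 := ae_pos_of_hasLaw_gammaMeasure hF
  have h1 : (fun ω => X ω ^ (k : ℝ) * F ω ^ (-(k : ℝ))) =ᵐ[μ] fun ω => (X ω / F ω) ^ k := by
    filter_upwards [hX0, hF0] with ω hX hF
    rw [Real.rpow_neg hF.le, Real.rpow_natCast, Real.rpow_natCast, div_pow, div_eq_mul_inv]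
  have hi := hind.comp (φ := fun t => t ^ (k : ℝ)) (ψ := fun t => t ^ (-(k : ℝ)))
    (by fun_prop) (by fun_prop)
  have hXi : Integrable (fun ω => X ω ^ (k : ℝ)) μ := by
    have := integrable_rpow_gammaMeasure (s := (k : ℝ)) ha hc (by positivity)
    rw [← hX.map_eq] at this
    exact this.comp_aemeasurable hX.aemeasurable
  -- The negative moment of a gamma variable of shape `b` is finite because `k < b`; this is the
  -- source of the thresholds `m > 1` and `m > 2`.
  have hFi : Integrable (fun ω => F ω ^ (-(k : ℝ))) μ := by
    have := integrable_rpow_gammaMeasure (s := -(k : ℝ)) hb hr (by linarith)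
    rw [← hF.map_eq] at this
    exact this.comp_aemeasurable hF.aemeasurable
  refine ⟨(hi.integrable_mul hXi hFi).congr h1, ?_⟩
  have hXe := hX.integral_comp (f := fun t => t ^ (k : ℝ)) (by fun_prop)
  have hFe := hF.integral_comp (f := fun t => t ^ (-(k : ℝ))) (by fun_prop)
  rw [integral_rpow_gammaMeasure ha hc (by positivity)] at hXe
  rw [integral_rpow_gammaMeasure hb hr (by linarith)] at hFe
  rw [← integral_congr_ae h1]
  refine (hi.integral_fun_mul_eq_mul_integral hXi.aestronglyMeasurable
    hFi.aestronglyMeasurable).trans ?_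
  rw [hXe, hFe, Real.rpow_neg hr.le, Real.rpow_natCast, Real.rpow_natCast, ← sub_eq_add_neg]
  congr 1
  field_simp

end Ratio

/-- The distribution function of the ratio of an exponential and an independent gamma variable. -/
lemma extCdf_ofReal_div_of_exponential {Ω : Type*} [MeasurableSpace Ω] {μ : Measure Ω}
    [IsProbabilityMeasure μ] {X F : Ω → ℝ} {m c : ℝ} (hm : 0 < m) (hc : 0 < c)
    (hX : HasLaw X (gammaMeasure 1 c) μ) (hF : HasLaw F (gammaMeasure m m) μ)
    (hind : IndepFun X F μ) {x : ℝ} (hx : 0 ≤ x) :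
    extCdf μ (fun ω => ENNReal.ofReal (X ω) / ENNReal.ofReal (F ω)) x
      = 1 - (m / (c * x + m)) ^ m := by
  have hX0 := ae_pos_of_hasLaw_gammaMeasure hX
  have hF0 := ae_pos_of_hasLaw_gammaMeasure hF
  rcases hx.eq_or_lt with rfl | hx0
  · rw [extCdf_ofReal_div_of_nonpos hX0 le_rfl, mul_zero, zero_add, div_self hm.ne',
      Real.one_rpow, sub_self]
  -- For shape `1` the beta prime density is an exact derivative, and writing it with exponent `-m -
  -- 1` exposes the antiderivative used below.
  have hlaw := hasLaw_posDensity_congr (hasLaw_div_of_gammaMeasure one_pos hm hc hm hX hF hind)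
    (g' := fun u => m ^ m * (c * m * (c * u + m) ^ (-m - 1))) fun u hu => by
      have h1 : (c * u + m) ^ (-m - 1) = ((m + c * u) ^ (1 + m))⁻¹ := by
        rw [← Real.rpow_neg (by positivity)]; ring_nf
      have := (Real.Gamma_pos_of_pos hm).ne'
      rw [h1, add_comm 1 m, Real.Gamma_add_one hm.ne', Real.Gamma_one, Real.rpow_one, sub_self,
        Real.rpow_zero]
      field_simp
  have hprob := hlaw.isProbabilityMeasure_iff.1 inferInstance
  have hset : extCdf μ (fun ω => ENNReal.ofReal (X ω) / ENNReal.ofReal (F ω)) x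
      = μ.real {ω | X ω / F ω ≤ x} := by
    refine measureReal_congr ?_
    filter_upwards [hX0, hF0] with ω h1 h2
    exact propext ((ofReal_div_ofReal_le_iff h1 hx0).trans (div_le_iff₀ h2).symm)
  have hder : ∀ t ∈ Ici x, HasDerivAt (fun t => -(m ^ m * (c * t + m) ^ (-m)))
      (m ^ m * (c * m * (c * t + m) ^ (-m - 1))) t := fun t ht => by
    have ht0 : 0 < t := lt_of_lt_of_le hx0 ht
    have h := (((((hasDerivAt_id t).const_mul c).add_const m).rpow_const (p := -m)
      (Or.inl (by simp only [id]; positivity))).const_mul (m ^ m)).fun_neg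
    convert! h using 1
    simp only [id]
    ring
  have hnn : ∀ t ∈ Ioi x, 0 ≤ m ^ m * (c * m * (c * t + m) ^ (-m - 1)) := fun t ht => by
    have : 0 < t := hx0.trans ht
    positivity
  have hlim : Filter.Tendsto (fun t => -(m ^ m * (c * t + m) ^ (-m))) Filter.atTop (nhds 0) := by
    have h1 : Filter.Tendsto (fun t => c * t + m) Filter.atTop Filter.atTop :=
      Filter.tendsto_atTop_add_const_right _ _ (Filter.tendsto_id.const_mul_atTop hc)
    simpa using (((tendsto_rpow_neg_atTop hm).comp h1).const_mul (m ^ m)).neg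
  have hcompl : {t : ℝ | t ≤ x} = (Ioi x)ᶜ := by ext; simp
  rw [hset, hlaw.measureReal_eq (p := fun t => t ≤ x) measurableSet_Iic, hcompl,
    probReal_compl_eq_one_sub measurableSet_Ioi, measureReal_def,
    posDensity_apply _ measurableSet_Ioi, inter_eq_left.2 (Ioi_subset_Ioi hx),
    ← integral_eq_lintegral_of_nonneg_ae ((ae_restrict_mem measurableSet_Ioi).mono hnn)
      (by fun_prop : Measurable _).aestronglyMeasurable,
    integral_Ioi_of_hasDerivAt_of_nonneg' hder hnn hlim,
    Real.div_rpow hm.le (by positivity), Real.rpow_neg (by positivity)]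
  ring

/-! ### Path losses with fading. -/

section Fading

variable {Ω : Type*} [MeasurableSpace Ω] {μ : Measure Ω} {d : ℕ} {α : ℝ}
  {y : ℕ+ → Ω → EuclideanSpace ℝ (Fin d)} {f : ℕ+ → Ω → ℝ} {ν : Measure ℝ}

lemma IsFading.indepFun_pathLoss (hf : IsFading μ y f ν) (i : ℕ+) :
    IndepFun (pathLoss α y i) (f i) μ :=
  hf.indep_points.symm.comp (φ := fun v : ℕ+ → EuclideanSpace ℝ (Fin d) => ‖v i‖ ^ α)
    (ψ := fun v : ℕ+ → ℝ => v i) (by fun_prop) (by fun_prop)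

lemma ae_toReal_fadedPathLoss (i : ℕ+) {a b c r : ℝ}
    (hX : HasLaw (pathLoss α y i) (gammaMeasure a c) μ)
    (hF : HasLaw (f i) (gammaMeasure b r) μ) :
    (fun ω => (fadedPathLoss α y f i ω).toReal) =ᵐ[μ] fun ω => pathLoss α y i ω / f i ω := by
  filter_upwards [ae_pos_of_hasLaw_gammaMeasure hX, ae_pos_of_hasLaw_gammaMeasure hF] with ω h1 h2
  exact toReal_ofReal_div_ofReal h1 h2

variable [IsProbabilityMeasure μ] (hd : 0 < d) (hα : 0 < α) (hy : IsUnitPoissonProcess μ y)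
  (hord : OrderedByDistance μ y) (hf : IsFading μ y f ν) (i : ℕ+)

include hd hα hy hord

lemma ae_pathLoss_pos : ∀ᵐ ω ∂μ, 0 < pathLoss α y i ω :=
  ae_pos_of_hasLaw_posDensity (hasLaw_pathLoss hd hα rfl hy hord i)

lemma extCdf_fadedPathLoss_of_nonpos {x : ℝ} (hx : x ≤ 0) :
    extCdf μ (fadedPathLoss α y f i) x = 0 :=
  extCdf_ofReal_div_of_nonpos (ae_pathLoss_pos hd hα hy hord i) hx

include hf

lemma extCdf_fadedPathLoss {δ : ℝ} (hδ : δ = (d : ℝ) / α) {x : ℝ} (hx : 0 < x) :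
    IntegrableOn (fun r : ℝ => cdf ν (r / x) * (ballConst d ^ (i : ℕ) * δ
        * r ^ (δ * (i : ℕ) - 1) * Real.exp (-(ballConst d * r ^ δ))
          / Real.Gamma (i : ℕ))) (Ioi 0) ∧
      extCdf μ (fadedPathLoss α y f i) x
        = 1 - ∫ r in Ioi (0 : ℝ), cdf ν (r / x) * (ballConst d ^ (i : ℕ) * δ
            * r ^ (δ * (i : ℕ) - 1) * Real.exp (-(ballConst d * r ^ δ))
              / Real.Gamma (i : ℕ)) := by
  have hδ0 : 0 < δ := by rw [hδ]; positivity
  have hc := ballConst_pos d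
  have hΓ : 0 < Real.Gamma (i : ℕ) := Real.Gamma_pos_of_pos (by exact_mod_cast i.pos)
  have hlaw := hasLaw_pathLoss hd hα hδ hy hord i
  have := hlaw.isProbabilityMeasure_iff.1 inferInstance
  have hnn : ∀ r : ℝ, 0 < r → 0 ≤ ballConst d ^ (i : ℕ) * δ * r ^ (δ * (i : ℕ) - 1)
      * Real.exp (-(ballConst d * r ^ δ)) / Real.Gamma (i : ℕ) := fun r hr => by positivity
  refine ⟨(integrable_posDensity_iff (by fun_prop) hnn).1 (integrable_cdf_div _ ν x), ?_⟩
  rw [← integral_posDensity (by fun_prop) hnn]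
  exact extCdf_ofReal_div_eq hlaw (hf.law i) (hf.indepFun_pathLoss i)
    (ae_pathLoss_pos hd hα hy hord i) hx

/-- The integral of `1 - exp (-r / x)` against the Erlang law is one minus its Laplace transform at
`1 / x`, and that transform is an `i`-th power. -/
lemma extCdf_fadedPathLoss_rayleigh (hδ : 1 = (d : ℝ) / α)
    (hν : ∀ x : ℝ, cdf ν x = if 0 ≤ x then 1 - Real.exp (-x) else 0) {x : ℝ} (hx : 0 ≤ x) :
    extCdf μ (fadedPathLoss α y f i) x
      = (ballConst d * x / (ballConst d * x + 1)) ^ (i : ℕ) := by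
  have hc := ballConst_pos d
  have hi : (0 : ℝ) < (i : ℕ) := by exact_mod_cast i.pos
  rcases hx.eq_or_lt with rfl | hx0
  · rw [extCdf_fadedPathLoss_of_nonpos hd hα hy hord i le_rfl]
    simp
  have hlaw := hasLaw_pathLoss_gammaMeasure hd hα hy hord i hδ
  have := isProbabilityMeasure_gammaMeasure hi hc
  have hnull : NullSingletonClass (gammaMeasure (i : ℕ) (ballConst d)) := by
    rw [gammaMeasure_eq_posDensity]; infer_instance
  refine (extCdf_ofReal_div_eq hlaw (hf.law i) (hf.indepFun_pathLoss i)
    (ae_pathLoss_pos hd hα hy hord i) hx0).trans ?_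
  have hae : ∀ᵐ r ∂(gammaMeasure (i : ℕ) (ballConst d)),
      cdf ν (r / x) = 1 - Real.exp (-(1 / x * r)) := by
    filter_upwards [ae_pos_of_hasLaw_gammaMeasure (X := fun r => r)
      (HasLaw.id (μ := gammaMeasure (i : ℕ) (ballConst d)))] with r hr
    rw [hν, if_pos (by positivity), one_div_mul_eq_div]
  rw [integral_congr_ae hae, integral_sub (integrable_const _)
    (integrable_exp_neg_mul_gammaMeasure hi hc (by positivity)),
    integral_exp_neg_mul_gammaMeasure hi hc (by positivity), Real.rpow_natCast]
  simp only [integral_const, probReal_univ, one_smul, sub_sub_cancel]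
  congr 1
  field_simp

end Fading

lemma fadedPathLoss_nakagami {Ω : Type*} [MeasurableSpace Ω] {μ : Measure Ω}
    [IsProbabilityMeasure μ] {X F : Ω → ℝ} {ξ : Ω → ℝ} {m c : ℝ} (hm : 0 < m) (hc : 0 < c)
    (i : ℕ+) (hX : HasLaw X (gammaMeasure (i : ℕ) c) μ) (hF : HasLaw F (gammaMeasure m m) μ)
    (hind : IndepFun X F μ) (hξ : ξ =ᵐ[μ] fun ω => X ω / F ω) :
    HasDensityOnPos μ ξ
        (fun x => m ^ (m + 1) * realBinom (m + (i : ℕ) - 1) m * c ^ (i : ℕ)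
          * x ^ ((i : ℕ) - 1) / (m + c * x) ^ (m + (i : ℕ))) ∧
      (1 < m → Integrable ξ μ ∧ ∫ ω, ξ ω ∂μ = m * (i : ℕ) / (c * (m - 1))) ∧
      (2 < m → MemLp ξ 2 μ ∧ variance ξ μ
        = m ^ 2 * (i : ℕ) * (m + (i : ℕ) - 1) / (c ^ 2 * (m - 1) ^ 2 * (m - 2))) := by
  have hi : (0 : ℝ) < (i : ℕ) := by exact_mod_cast i.pos
  have hΓi := (Real.Gamma_pos_of_pos hi).ne'
  have hΓm := (Real.Gamma_pos_of_pos hm).ne'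
  have hi1 : Real.Gamma ((i : ℕ) + 1) = (i : ℕ) * Real.Gamma (i : ℕ) := Real.Gamma_add_one hi.ne'
  have hm1 : 1 < m → Integrable ξ μ ∧ ∫ ω, ξ ω ∂μ = m * (i : ℕ) / (c * (m - 1)) := fun h1 => by
    obtain ⟨h2, h3⟩ := moment_div_of_gammaMeasure hi hm hc hm hX hF hind 1 (by simpa using h1)
    simp only [pow_one, Nat.cast_one] at h2 h3
    refine ⟨h2.congr hξ.symm, ?_⟩
    have h4 : 0 < m - 1 := by linarith
    have h5 : Real.Gamma m = (m - 1) * Real.Gamma (m - 1) := by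
      rw [← Real.Gamma_add_one h4.ne']; ring_nf
    have := (Real.Gamma_pos_of_pos h4).ne'
    rw [integral_congr_ae hξ, h3, hi1, h5]
    field_simp
  refine ⟨?_, hm1, fun h1 => ?_⟩
  · refine HasLaw.congr (hasLaw_posDensity_congr
      (hasLaw_div_of_gammaMeasure hi hm hc hm hX hF hind) fun x hx => ?_) hξ
    have e1 : x ^ (((i : ℕ) : ℝ) - 1) = x ^ ((i : ℕ) - 1) := by
      rw [← Real.rpow_natCast, Nat.cast_pred i.pos]
    -- The last Gamma factor of the binomial coefficient is thus `Γ(i)`. The remaining factor `Γ(m +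
    -- 1) = m Γ(m)` accounts for the exponent `m + 1` in place of `m`.
    have e2 : m + ((i : ℕ) : ℝ) - 1 - m + 1 = (i : ℕ) := by ring
    rw [realBinom, e1, e2, sub_add_cancel, Real.rpow_natCast, Real.Gamma_add_one hm.ne',
      Real.rpow_add_one hm.ne', add_comm ((i : ℕ) : ℝ) m, add_comm m (c * x)]
    field_simp
  · obtain ⟨h2, h3⟩ := moment_div_of_gammaMeasure hi hm hc hm hX hF hind 2 (by simpa using h1)
    obtain ⟨h4, h5⟩ := hm1 (by linarith)
    have hsq : (fun ω => ξ ω ^ 2) =ᵐ[μ] fun ω => (X ω / F ω) ^ 2 := by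
      filter_upwards [hξ] with ω hω
      rw [hω]
    have hmem : MemLp ξ 2 μ :=
      (memLp_two_iff_integrable_sq h4.aestronglyMeasurable).2 (h2.congr hsq.symm)
    refine ⟨hmem, ?_⟩
    have h6 : 0 < m - 2 := by linarith
    have h7 : 0 < m - 1 := by linarith
    -- The Gamma recursion is applied down to `m - 2`, which is positive, to cancel the Gamma
    -- factors in the second moment.
    have h8 : Real.Gamma m = (m - 1) * ((m - 2) * Real.Gamma (m - 2)) := by
      rw [← Real.Gamma_add_one h6.ne', show m - 2 + 1 = m - 1 by ring,
        ← Real.Gamma_add_one h7.ne']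
      ring_nf
    have h9 : Real.Gamma ((i : ℕ) + 2) = ((i : ℕ) + 1) * ((i : ℕ) * Real.Gamma (i : ℕ)) := by
      rw [← hi1, ← Real.Gamma_add_one (by positivity)]; ring_nf
    have := (Real.Gamma_pos_of_pos h6).ne'
    rw [variance_eq_sub hmem, h5]
    simp only [Pi.pow_apply]
    rw [integral_congr_ae hsq, h3, Nat.cast_ofNat, h8, h9]
    field_simp
    ring

theorem mainTheorem6 {Ω : Type*} [MeasurableSpace Ω] (μ : Measure Ω) [IsProbabilityMeasure μ]
    (d : ℕ) (hd : 0 < d) (α : ℝ) (hα : 0 < α) (δ : ℝ) (hδ : δ = (d : ℝ) / α)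
    (c : ℝ) (hc : c = ballConst d)
    (y : ℕ+ → Ω → EuclideanSpace ℝ (Fin d)) (hy : IsUnitPoissonProcess μ y)
    (hord : OrderedByDistance μ y)
    (ν : Measure ℝ) (hν : IsFadingLaw ν)
    (f : ℕ+ → Ω → ℝ) (hf : IsFading μ y f ν) :
    -- (a) the counting measure of the path loss process, its density, stationarity
    ((∀ x : ℝ, 0 ≤ x →
        meanCount μ (pathLoss α y) (Ico 0 x) = ENNReal.ofReal (c * x ^ δ)) ∧
      (∀ x : ℝ, 0 < x →
        HasDerivAt (fun a : ℝ => (meanCount μ (pathLoss α y) (Ico 0 a)).toReal)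
          (c * δ * x ^ (δ - 1)) x) ∧
      (∀ B : Set ℝ, MeasurableSet B →
        meanCount μ (pathLoss α y) B
          = ∫⁻ x in B ∩ Ioi 0, ENNReal.ofReal (c * δ * x ^ (δ - 1))) ∧
      (δ = 1 → IsStationaryOnHalfLine μ (pathLoss α y))) ∧
    -- (b) the laws of the distances and of the path losses without fading
    (∀ i : ℕ+,
      HasDensityOnPos μ (nodeDist y i)
        (fun r => Real.exp (-(c * r ^ d)) * ((d : ℝ) * (c * r ^ d) ^ (i : ℕ)
          / (r * Real.Gamma (i : ℕ)))) ∧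
      (∀ x : ℝ, 0 ≤ x → cdf (μ.map (pathLoss α y i)) x
        = 1 - upperGamma (i : ℕ) (c * x ^ δ) / Real.Gamma (i : ℕ)) ∧
      (∀ x : ℝ, x < 0 → cdf (μ.map (pathLoss α y i)) x = 0) ∧
      Integrable (pathLoss α y i) μ ∧
      ∫ ω, pathLoss α y i ω ∂μ
        = c ^ (-(1 / δ)) * (Real.Gamma ((i : ℕ) + 1 / δ) / Real.Gamma (i : ℕ)) ∧
      (δ = 1 → HasLaw (pathLoss α y i) (gammaMeasure (i : ℕ) c) μ ∧
        ∫ ω, pathLoss α y i ω ∂μ = (i : ℕ) / c)) ∧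
    -- (c) the laws of the path losses with fading: general distribution function
    (∀ i : ℕ+,
      (∀ x : ℝ, x ≤ 0 → extCdf μ (fadedPathLoss α y f i) x = 0) ∧
      (∀ x : ℝ, 0 < x →
        IntegrableOn (fun r : ℝ => cdf ν (r / x) *
          (c ^ (i : ℕ) * δ * r ^ (δ * (i : ℕ) - 1) * Real.exp (-(c * r ^ δ))
            / Real.Gamma (i : ℕ))) (Ioi 0) ∧
        extCdf μ (fadedPathLoss α y f i) x
          = 1 - ∫ r in Ioi (0 : ℝ), cdf ν (r / x) *
            (c ^ (i : ℕ) * δ * r ^ (δ * (i : ℕ) - 1) * Real.exp (-(c * r ^ δ))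
              / Real.Gamma (i : ℕ)))) ∧
    -- (c) the case `δ = 1` with Nakagami-`m` fading
    (δ = 1 → ∀ m : ℝ, 0 < m → ν = gammaMeasure m m →
      (∀ i : ℕ+,
        (∀ᵐ ω ∂μ, fadedPathLoss α y f i ω ≠ ∞) ∧
        HasDensityOnPos μ (fun ω => (fadedPathLoss α y f i ω).toReal)
          (fun x => m ^ (m + 1) * realBinom (m + (i : ℕ) - 1) m * c ^ (i : ℕ)
            * x ^ ((i : ℕ) - 1) / (m + c * x) ^ (m + (i : ℕ))) ∧
        (1 < m →
          Integrable (fun ω => (fadedPathLoss α y f i ω).toReal) μ ∧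
          ∫ ω, (fadedPathLoss α y f i ω).toReal ∂μ = m * (i : ℕ) / (c * (m - 1))) ∧
        (2 < m →
          MemLp (fun ω => (fadedPathLoss α y f i ω).toReal) 2 μ ∧
          variance (fun ω => (fadedPathLoss α y f i ω).toReal) μ
            = m ^ 2 * (i : ℕ) * (m + (i : ℕ) - 1)
              / (c ^ 2 * (m - 1) ^ 2 * (m - 2)))) ∧
      (∀ x : ℝ, 0 ≤ x →
        extCdf μ (fadedPathLoss α y f 1) x = 1 - (m / (c * x + m)) ^ m)) ∧
    -- (c) the standard network: `δ = 1` and Rayleigh fading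
    (δ = 1 → (∀ x : ℝ, cdf ν x = if 0 ≤ x then 1 - Real.exp (-x) else 0) →
      ∀ (i : ℕ+) (x : ℝ), 0 ≤ x →
        extCdf μ (fadedPathLoss α y f i) x = (c * x / (c * x + 1)) ^ (i : ℕ)) := by
  subst hc
  have hc0 := ballConst_pos d
  have hδ0 : 0 < δ := by rw [hδ]; positivity
  refine ⟨⟨fun x hx => hy.meanCount_pathLoss_Ico hd hα hδ hx,
    fun x hx => hy.hasDerivAt_meanCount_pathLoss hd hα hδ hx,
    fun B hB => hy.meanCount_pathLoss_eq_lintegral hd hα hδ hB,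
    fun h => hy.isStationaryOnHalfLine_pathLoss hd hα (h ▸ hδ)⟩,
    fun i => ⟨hasDensityOnPos_nodeDist hd hy hord i,
      fun x hx => cdf_pathLoss hd hα hδ hy hord i hx,
      fun x hx => cdf_pathLoss_of_neg hy i hx,
      integrable_pathLoss hd hα hδ hy hord i, integral_pathLoss hd hα hδ hy hord i,
      fun h => ⟨hasLaw_pathLoss_gammaMeasure hd hα hy hord i (h ▸ hδ), ?_⟩⟩,
    fun i => ⟨fun x hx => extCdf_fadedPathLoss_of_nonpos hd hα hy hord i hx,
      fun x hx => extCdf_fadedPathLoss hd hα hy hord hf i hδ hx⟩, ?_,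
    fun h hν' i x hx => extCdf_fadedPathLoss_rayleigh hd hα hy hord hf i (h ▸ hδ) hν' hx⟩
  · have hi : (0 : ℝ) < (i : ℕ) := by exact_mod_cast i.pos
    have := (Real.Gamma_pos_of_pos hi).ne'
    rw [integral_pathLoss hd hα hδ hy hord i, h, div_one, Real.Gamma_add_one hi.ne',
      Real.rpow_neg_one]
    field_simp
  · intro h m hm hνm
    have hX := fun i => hasLaw_pathLoss_gammaMeasure hd hα hy hord i (h ▸ hδ)
    have hF : ∀ i, HasLaw (f i) (gammaMeasure m m) μ := fun i => hνm ▸ hf.law i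
    refine ⟨fun i => ⟨?_, fadedPathLoss_nakagami hm hc0 i (hX i) (hF i) (hf.indepFun_pathLoss i)
      (ae_toReal_fadedPathLoss i (hX i) (hF i))⟩, fun x hx => ?_⟩
    -- Finiteness holds because gamma fading is almost surely nonzero.
    · filter_upwards [ae_pos_of_hasLaw_gammaMeasure (hF i)] with ω hω
      exact ENNReal.div_ne_top ENNReal.ofReal_ne_top (by simpa using hω)
    · have hX1 := hX 1
      rw [PNat.one_coe, Nat.cast_one] at hX1
      exact extCdf_ofReal_div_of_exponential hm hc0 hX1 (hF 1) (hf.indepFun_pathLoss 1) hx
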